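/- There is an absolute constant $C>0$ such that the following holds. Let $d$ be a non-negative integer and let $F$ be a symmetric probability distribution on $\mathbb{Z}^d$, that is, $F\{-x\}=F\{x\}$ for all $x\in\mathbb{Z}^d$, such that $q:=F\{0\}\in(0,1)$. Put $p_x:=F\{x\}$ and, for $y\ge 0$, $$\delta(y)=\sum_{x\in\mathbb{Z}^d,\ x\neq 0}\min(1,\,y\,e\,p_x).$$ Let $I$ denote the distribution concentrated at $0$, let $*$ denote convolution of finite signed measures on $\mathbb{Z}^d$, and let $\exp\{M\}=\sum_{j\ge 0}M^{*j}/j!$ with $M^{*0}=I$. For distributions $G,H$ on $\mathbb{Z}^d$ let $d_{TV}(G,H)=\sup_{B\subseteq\mathbb{Z}^d}|G\{B\}-H\{B\}|$. Then, for every integer $n\ge 1$, $$d_{TV}\bigl(F^{*n},\exp\{n(F-I)\}\bigr)\le \frac{4\,\delta(n/2)^2}{e^2 n}\left(1+\frac{C\,(\delta(nq)+1)}{q^4\sqrt{n}}\right)+\frac{C\,(1-q)^{9/2}}{q^5\,n\sqrt{n}}.$$ -/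

import Mathlib

open MeasureTheory
open scoped ENNReal Nat

namespace CompoundPoisson

section General

variable {G : Type*} [MeasurableSpace G]

/-- The total variation distance `sup_B |M{B} - V{B}|`, the supremum being over all measurable
sets `B` (it is finite, since signed measures are bounded). -/
noncomputable def tvDist (M V : SignedMeasure G) : ℝ :=
  ⨆ B : {B : Set G // MeasurableSet B}, |M B.1 - V B.1|

theorem isFiniteMeasure_variation (M : SignedMeasure G) : IsFiniteMeasure M.variation := by
  rw [← M.totalVariation_eq_variation, SignedMeasure.totalVariation]
  infer_instance

theorem summable_abs_iUnion (M : SignedMeasure G) {f : ℕ → Set G}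
    (hf : ∀ i, MeasurableSet (f i)) (hd : Pairwise (Function.onFun Disjoint f)) :
    Summable (fun i => |M (f i)|) ∧
      ∑' i, |M (f i)| ≤ (M.variation Set.univ).toReal := by
  have := isFiniteMeasure_variation M
  have key : ∀ s : Finset ℕ, ∑ i ∈ s, |M (f i)| ≤ (M.variation Set.univ).toReal := by
    intro s
    calc ∑ i ∈ s, |M (f i)| ≤ ∑ i ∈ s, M.variation.real (f i) :=
          Finset.sum_le_sum fun i _ => by
            simpa using VectorMeasure.norm_measure_le_variation (μ := M) (E := f i)
      _ = M.variation.real (⋃ i ∈ s, f i) :=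
          (measureReal_biUnion_finset (fun i _ j _ hij => hd hij) (fun i _ => hf i)).symm
      _ ≤ _ := measureReal_mono (Set.subset_univ _)
  exact ⟨summable_of_sum_le (fun _ => abs_nonneg _) key,
    Real.tsum_le_of_sum_le (fun _ => abs_nonneg _) key⟩

variable [AddCommGroup G]

/-- The distribution `I` concentrated at `0`, as a signed measure. -/
noncomputable def unit (G : Type*) [MeasurableSpace G] [AddCommGroup G] : SignedMeasure G :=
  (Measure.dirac (0 : G)).toSignedMeasure

/-- The convolution `M * V` of two finite signed measures: the image under addition of the
product measure. -/
noncomputable def conv (M V : SignedMeasure G) : SignedMeasure G :=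
  (VectorMeasure.prod M V (ContinuousLinearMap.mul ℝ ℝ)).map (fun p : G × G => p.1 + p.2)

/-- Convolution powers: `M^{*0} = I` and `M^{*(j+1)} = M^{*j} * M`. -/
noncomputable def convPow (M : SignedMeasure G) : ℕ → SignedMeasure G
  | 0 => unit G
  | j + 1 => conv (convPow M j) M

theorem variation_conv_le (M V : SignedMeasure G) :
    (conv M V).variation Set.univ ≤ M.variation Set.univ * V.variation Set.univ := by
  have := isFiniteMeasure_variation M
  have := isFiniteMeasure_variation V
  have hB : ‖ContinuousLinearMap.mul ℝ ℝ‖ₑ ≤ 1 := by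
    rw [← enorm_one (G := ℝ), enorm_le_iff_norm_le]; simp
  by_cases hm : Measurable (fun p : G × G => p.1 + p.2)
  · calc (conv M V).variation Set.univ
        ≤ ((VectorMeasure.prod M V (ContinuousLinearMap.mul ℝ ℝ)).variation.map
            (fun p : G × G => p.1 + p.2)) Set.univ := VectorMeasure.variation_map_le _
      _ = (VectorMeasure.prod M V (ContinuousLinearMap.mul ℝ ℝ)).variation Set.univ := by
          rw [Measure.map_apply hm MeasurableSet.univ, Set.preimage_univ]
      _ ≤ (‖ContinuousLinearMap.mul ℝ ℝ‖ₑ • M.variation.prod V.variation) Set.univ :=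
          VectorMeasure.variation_prod_le _
      _ ≤ M.variation Set.univ * V.variation Set.univ := by
          rw [Measure.smul_apply, smul_eq_mul, ← Set.univ_prod_univ, Measure.prod_prod]
          exact mul_le_of_le_one_left' hB
  · simp [conv, VectorMeasure.map, hm]

theorem variation_convPow_le (M : SignedMeasure G) (j : ℕ) :
    (convPow M j).variation Set.univ ≤ (M.variation Set.univ) ^ j := by
  induction j with
  | zero => simp [convPow, unit]
  | succ j ih =>
    rw [pow_succ]
    exact (variation_conv_le _ _).trans (by gcongr)

/-- The exponential measure `exp{M} = ∑_{j ≥ 0} M^{*j} / j!` of a finite signed measure. -/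
noncomputable def expMeasure (M : SignedMeasure G) : SignedMeasure G where
  measureOf' B := ∑' j : ℕ, convPow M j B / (j ! : ℝ)
  empty' := by simp
  not_measurable' B hB := by simp [VectorMeasure.not_measurable _ hB]
  m_iUnion' f hf hd := by
    have := isFiniteMeasure_variation M
    set a : ℝ := (M.variation Set.univ).toReal with ha
    have hbound : ∀ j, ((convPow M j).variation Set.univ).toReal ≤ a ^ j := by
      intro j
      rw [ha, ← ENNReal.toReal_pow]
      exact ENNReal.toReal_mono (by finiteness) (variation_convPow_le M j)
    have hs : Summable (fun p : ℕ × ℕ => convPow M p.1 (f p.2) / (p.1 ! : ℝ)) := by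
      rw [← summable_abs_iff]
      refine (summable_prod_of_nonneg (fun _ => abs_nonneg _)).2 ⟨fun j => ?_, ?_⟩
      · simpa [abs_div] using ((summable_abs_iUnion (convPow M j) hf hd).1).div_const _
      · refine Summable.of_nonneg_of_le (fun j => tsum_nonneg fun _ => abs_nonneg _) (fun j => ?_)
          (Real.summable_pow_div_factorial a)
        simp only [abs_div, Nat.abs_cast]
        rw [tsum_div_const]
        gcongr
        exact (summable_abs_iUnion (convPow M j) hf hd).2.trans (hbound j)
    have hs' : Summable (fun p : ℕ × ℕ => convPow M p.2 (f p.1) / (p.2 ! : ℝ)) :=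
      hs.prod_symm
    have h1 := hs'.hasSum.prod_fiberwise (fun i => (hs'.prod_factor i).hasSum)
    convert h1 using 1
    rw [← (Equiv.prodComm ℕ ℕ).tsum_eq]
    simp only [Equiv.prodComm_apply, Prod.fst_swap, Prod.snd_swap]
    rw [hs.tsum_prod' hs.prod_factor]
    refine tsum_congr fun j => ?_
    exact ((((convPow M j).m_iUnion hf hd).div_const _).tsum_eq).symm

end General

/-- The function `δ(y) = ∑_{x ≠ 0} min(1, y e F{x})` of a distribution `F` on `ℤ^d`. -/
noncomputable def delta {d : ℕ} (F : Measure (Fin d → ℤ)) (y : ℝ) : ℝ :=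
  ∑' x : {x : Fin d → ℤ // x ≠ 0}, min 1 (y * Real.exp 1 * F.real {x.1})

end CompoundPoisson

/-! A measure `M` acts on bounded functions as the operator `∑ M{x} T x`, with `T x` translation.
Convolution becomes composition and `expMeasure` becomes the operator exponential, while the total
variation distance of measures of equal mass is at most half the operator norm of the difference. So
it suffices to estimate `F ^ n - E ^ n`, `E = exp (F - 1)`, in a commutative Banach algebra
generated by elements `T x` of norm at most 1.

Expanding to second order in `F - E` and using `‖Y (F - E)‖ ≤ ‖Y (F - 1)²‖ / 2` leaves a main term
`n / 2 * ‖E ^ (n - 1) (F - 1)²‖` and a remainder of order `n²` times `‖F ^ j E ^ (n - 2 - j) (F -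
1)⁴‖`. Each factor `F - 1` is paired with a share of the powers of `E` or `F`, which smooths it. By
symmetry `F - 1` is a sum of `(p x / 2)(T x + T (-x) - 2)`, and `T x + T (-x) - 2 = -(T x - 1)(T
(-x) - 1)`. The variances of Poisson and binomial laws give each of the two factors a gain of order
`(t p x)^(-1/2)`, so a pair contributes `O(1/t)` whatever `p x` is. Combined with the trivial bound
`2 * p x`, summation over `x` produces `δ / t` (`mul_norm_pair_mul_exp_le`,
`mul_norm_pair_mul_pow_le`, `norm_sub_one_mul_le_truncatedMass`).

The main term, with half of `E ^ (n - 1)` per factor, gives exactly `4 δ(n/2)² / (e² n)`. In the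
remainder two factors give `δ(n/2) / (nq)`, one gives `δ(nq) / (nq)`, and the last gives
`(nq)^(-1/2)`. -/

namespace CompoundPoisson

/-! ### Comparison of `F ^ n` with `exp (n (F - 1))` in a Banach algebra. -/

section BanachAlgebra

variable {A : Type*} [NormedCommRing A] [NormedAlgebra ℝ A]

theorem exp_smul_one (c : ℝ) : NormedSpace.exp (c • (1 : A)) = Real.exp c • (1 : A) := by
  rw [← Algebra.algebraMap_eq_smul_one, ← Algebra.algebraMap_eq_smul_one, Real.exp_eq_exp_ℝ,
    NormedSpace.algebraMap_exp_comm]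

variable [CompleteSpace A]

theorem exp_add' (x y : A) :
    NormedSpace.exp (x + y) = NormedSpace.exp x * NormedSpace.exp y := by
  let : NormedAlgebra ℚ A := NormedAlgebra.restrictScalars ℚ ℝ A
  exact NormedSpace.exp_add

theorem exp_natCast_smul (n : ℕ) (x : A) :
    NormedSpace.exp ((n : ℝ) • x) = NormedSpace.exp x ^ n := by
  let : NormedAlgebra ℚ A := NormedAlgebra.restrictScalars ℚ ℝ A
  rw [Nat.cast_smul_eq_nsmul, NormedSpace.exp_nsmul]

theorem hasDerivAt_mul_exp_smul (Y R : A) (s : ℝ) :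
    HasDerivAt (fun s : ℝ => Y * NormedSpace.exp (s • R))
      (Y * R * NormedSpace.exp (s • R)) s := by
  have h := (hasDerivAt_exp_smul_const R s).const_mul Y
  convert h using 1
  ring

variable [NormOneClass A]

theorem norm_exp_le_exp_norm (x : A) : ‖NormedSpace.exp x‖ ≤ Real.exp ‖x‖ := by
  have h := NormedSpace.exp_series_hasSum_exp' (𝕂 := ℝ) x
  have h' := NormedSpace.exp_series_hasSum_exp' (𝕂 := ℝ) ‖x‖
  rw [← Real.exp_eq_exp_ℝ] at h'
  refine h.norm_le_of_bounded h' fun k => ?_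
  rw [norm_smul, smul_eq_mul]
  refine mul_le_mul (le_of_eq ?_) (norm_pow_le x k) (norm_nonneg _) (by positivity)
  simp

/-- An exponential with a dominating drift is a contraction. -/
theorem norm_exp_sub_smul_one_le {x : A} {c : ℝ} (h : ‖x‖ ≤ c) :
    ‖NormedSpace.exp (x - c • (1 : A))‖ ≤ 1 := by
  rw [sub_eq_add_neg, ← neg_smul, exp_add', exp_smul_one, mul_smul_comm, mul_one, norm_smul,
    Real.norm_eq_abs, Real.abs_exp]
  calc Real.exp (-c) * ‖NormedSpace.exp x‖ ≤ Real.exp (-c) * Real.exp c := by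
        gcongr
        exact (norm_exp_le_exp_norm x).trans (Real.exp_le_exp.2 h)
    _ = 1 := by rw [← Real.exp_add]; simp

theorem norm_exp_smul_sub_one_le {F : A} (hF : ‖F‖ ≤ 1) {t : ℝ} (ht : 0 ≤ t) :
    ‖NormedSpace.exp (t • (F - 1))‖ ≤ 1 := by
  rw [smul_sub]
  refine norm_exp_sub_smul_one_le ?_
  rw [norm_smul, Real.norm_of_nonneg ht]
  exact mul_le_of_le_one_right ht hF

/-- Second order Taylor bound for `exp (F - 1)`, tested against an arbitrary factor. -/
theorem norm_mul_exp_sub_le {F : A} (hF : ‖F‖ ≤ 1) (Y : A) :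
    ‖Y * (NormedSpace.exp (F - 1) - F)‖ ≤ ‖Y * (F - 1) ^ 2‖ / 2 := by
  set R := F - 1 with hR
  set K := ‖Y * R ^ 2‖
  -- Two integrations of the second derivative `Y R² exp (s R)`, bounded by `K` because `exp (s R)`
  -- is a contraction. `Y` stays inside the norm so that its smoothing effect on `R²` survives.
  have h1 : ∀ s ∈ Set.Icc (0 : ℝ) 1,
      ‖Y * R * NormedSpace.exp (s • R) - Y * R‖ ≤ K * s := by
    refine image_norm_le_of_norm_deriv_right_le_deriv_boundary
      (f' := fun s => Y * R * R * NormedSpace.exp (s • R)) (B' := fun _ => K)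
      (fun s _ => ((hasDerivAt_mul_exp_smul _ R s).sub_const _).continuousAt.continuousWithinAt)
      (fun s _ => ((hasDerivAt_mul_exp_smul _ R s).sub_const _).hasDerivWithinAt) (by simp)
      (fun s => by simpa using (hasDerivAt_id s).const_mul K) (fun s hs => ?_)
    calc ‖Y * R * R * NormedSpace.exp (s • R)‖
        ≤ ‖Y * R * R‖ * ‖NormedSpace.exp (s • R)‖ := norm_mul_le _ _
      _ ≤ ‖Y * R * R‖ * 1 := by gcongr; exact norm_exp_smul_sub_one_le hF hs.1
      _ = K := by rw [mul_one, mul_assoc, ← sq]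
  have hd : ∀ s : ℝ, HasDerivAt
      (fun s : ℝ => Y * NormedSpace.exp (s • R) - (Y + s • (Y * R)))
      (Y * R * NormedSpace.exp (s • R) - Y * R) s := fun s => by
    refine (hasDerivAt_mul_exp_smul Y R s).sub ?_
    simpa using ((hasDerivAt_id s).smul_const (Y * R)).const_add Y
  have h2 := image_norm_le_of_norm_deriv_right_le_deriv_boundary
    (f := fun s : ℝ => Y * NormedSpace.exp (s • R) - (Y + s • (Y * R)))
    (f' := fun s => Y * R * NormedSpace.exp (s • R) - Y * R) (B := fun s => K * s ^ 2 / 2)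
    (B' := fun s => K * s) (a := 0) (b := 1)
    (fun s _ => (hd s).continuousAt.continuousWithinAt)
    (fun s _ => (hd s).hasDerivWithinAt) (by simp)
    (fun s => by
      refine (((hasDerivAt_pow 2 s).const_mul K).div_const 2).congr_deriv ?_
      norm_num
      ring) (fun s hs => h1 s (Set.Ico_subset_Icc_self hs))
  have h3 := h2 (Set.right_mem_Icc.2 zero_le_one)
  have e : Y * (NormedSpace.exp R - F) =
      Y * NormedSpace.exp ((1 : ℝ) • R) - (Y + (1 : ℝ) • (Y * R)) := by
    rw [one_smul, one_smul, hR]; ring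
  rw [e]
  simpa using h3

theorem norm_pow_sub_exp_pow_le {F : A} (hF : ‖F‖ ≤ 1) (n : ℕ) :
    ‖F ^ n - NormedSpace.exp (F - 1) ^ n‖ ≤ n * (‖(F - 1) ^ 2‖ / 2) := by
  set E := NormedSpace.exp (F - 1) with hE
  have hE1 : ‖E‖ ≤ 1 := by simpa using norm_exp_smul_sub_one_le hF zero_le_one
  rw [← geom_sum₂_mul, Finset.sum_mul]
  refine (norm_sum_le _ _).trans ?_
  rw [← nsmul_eq_mul]
  refine (Finset.sum_le_card_nsmul _ _ _ fun i _ => ?_).trans_eq (by rw [Finset.card_range])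
  rw [← neg_sub E F, mul_neg, norm_neg]
  refine (norm_mul_exp_sub_le hF _).trans ?_
  gcongr
  refine (norm_mul_le _ _).trans (mul_le_of_le_one_left (norm_nonneg _) ?_)
  refine (norm_mul_le _ _).trans (mul_le_one₀ ?_ (norm_nonneg _) ?_)
  · exact (norm_pow_le _ _).trans (pow_le_one₀ (norm_nonneg _) hF)
  · exact (norm_pow_le _ _).trans (pow_le_one₀ (norm_nonneg _) hE1)

/-- Telescoping applied twice: first to `F ^ n - E ^ n`, then to `F ^ i - E ^ i` in each summand.
The powers of `E` produced by the two steps combine to an exponent independent of `i`. -/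
theorem pow_sub_pow_eq_second_order {B : Type*} [CommRing B] (F E : B) (n : ℕ) :
    F ^ n - E ^ n = (n : B) * E ^ (n - 1) * (F - E) +
      ∑ i ∈ Finset.range n, ∑ j ∈ Finset.range i,
        F ^ j * E ^ (n - 2 - j) * (F - E) * (F - E) := by
  rw [← geom_sum₂_mul, show (n : B) * E ^ (n - 1) =
    ∑ i ∈ Finset.range n, E ^ i * E ^ (n - 1 - i) from ?_, Finset.sum_mul, Finset.sum_mul,
    ← Finset.sum_add_distrib]
  · refine Finset.sum_congr rfl fun i hi => ?_
    have hi := Finset.mem_range.1 hi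
    have h := (geom_sum₂_mul F E i).symm
    rw [← Finset.sum_mul, show ∑ j ∈ Finset.range i, F ^ j * E ^ (n - 2 - j) * (F - E) =
      E ^ (n - 1 - i) * (F ^ i - E ^ i) from ?_]
    · ring
    · rw [h, Finset.sum_mul, Finset.mul_sum]
      refine Finset.sum_congr rfl fun j hj => ?_
      have hj := Finset.mem_range.1 hj
      rw [show n - 2 - j = (n - 1 - i) + (i - 1 - j) by omega, pow_add]
      ring
  · rw [Finset.sum_congr rfl fun i hi => ?_, Finset.sum_const, Finset.card_range, nsmul_eq_mul]
    have hi := Finset.mem_range.1 hi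
    rw [← pow_add, show i + (n - 1 - i) = n - 1 by omega]

/-- The second order comparison of `F ^ n` with `exp (n (F - 1))`. -/
theorem norm_pow_sub_exp_pow_le_second_order {F : A} (hF : ‖F‖ ≤ 1) {n : ℕ} (hn : 2 ≤ n)
    {K : ℝ}
    (hK : ∀ j, j + 2 ≤ n →
      ‖F ^ j * NormedSpace.exp (F - 1) ^ (n - 2 - j) * (F - 1) ^ 4‖ ≤ K) :
    ‖F ^ n - NormedSpace.exp (F - 1) ^ n‖ ≤
      n / 2 * ‖NormedSpace.exp (F - 1) ^ (n - 1) * (F - 1) ^ 2‖ + n ^ 2 / 4 * K := by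
  set E := NormedSpace.exp (F - 1) with hE
  have hFE : ∀ Y : A, ‖Y * (F - E)‖ ≤ ‖Y * (F - 1) ^ 2‖ / 2 := fun Y => by
    rw [← neg_sub E F, mul_neg, norm_neg]
    exact norm_mul_exp_sub_le hF _
  have hK0 : 0 ≤ K := (norm_nonneg _).trans (hK 0 (by omega))
  rw [pow_sub_pow_eq_second_order]
  refine (norm_add_le _ _).trans (add_le_add ?_ ?_)
  · rw [mul_assoc, ← nsmul_eq_mul]
    refine (norm_nsmul_le).trans ?_
    refine (mul_le_mul_of_nonneg_left (hFE _) (Nat.cast_nonneg _)).trans_eq ?_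
    ring
  · have h1 : ∀ i ∈ Finset.range n, ‖∑ j ∈ Finset.range i,
        F ^ j * E ^ (n - 2 - j) * (F - E) * (F - E)‖ ≤ n * (K / 4) := fun i hi => by
      have hi := Finset.mem_range.1 hi
      refine (norm_sum_le_of_le (f := fun j => F ^ j * E ^ (n - 2 - j) * (F - E) * (F - E))
        (n := fun _ => K / 4) _ fun j hj => ?_).trans ?_
      · have hj := Finset.mem_range.1 hj
        refine (hFE _).trans ?_
        rw [mul_right_comm _ (F - E)]
        have h2 := hFE (F ^ j * E ^ (n - 2 - j) * (F - 1) ^ 2)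
        rw [mul_assoc _ ((F - 1) ^ 2) ((F - 1) ^ 2), ← pow_add] at h2
        have h3 := hK j (by omega)
        linarith
      · rw [Finset.sum_const, Finset.card_range, nsmul_eq_mul]
        gcongr
    refine (norm_sum_le_of_le _ h1).trans_eq ?_
    rw [Finset.sum_const, Finset.card_range, nsmul_eq_mul]
    ring

end BanachAlgebra

/-! ### Smoothing by Poisson and binomial weights. -/

section Smoothing

variable {A : Type*} [NormedCommRing A] [NormedAlgebra ℝ A]

/-- The weights of the Poisson distribution with mean `t`. -/
noncomputable def poissonWeight (t : ℝ) (k : ℕ) : ℝ := Real.exp (-t) * (t ^ k / k !)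

theorem poissonWeight_nonneg {t : ℝ} (ht : 0 ≤ t) (k : ℕ) : 0 ≤ poissonWeight t k := by
  unfold poissonWeight; positivity

theorem succ_mul_poissonWeight_succ (t : ℝ) (k : ℕ) :
    ((k + 1 : ℕ) : ℝ) * poissonWeight t (k + 1) = t * poissonWeight t k := by
  unfold poissonWeight
  rw [Nat.factorial_succ]
  push_cast
  field_simp
  ring

section Complete

variable [CompleteSpace A]

theorem hasSum_poissonWeight_smul_pow (t : ℝ) (g : A) :
    HasSum (fun k => poissonWeight t k • g ^ k) (NormedSpace.exp (t • (g - 1))) := by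
  have h := (NormedSpace.exp_series_hasSum_exp' (𝕂 := ℝ) (t • g)).const_smul (Real.exp (-t))
  rw [smul_sub, sub_eq_add_neg, ← neg_smul, exp_add', exp_smul_one, mul_smul_comm, mul_one]
  refine h.congr_fun fun k => ?_
  rw [smul_pow, smul_smul, smul_smul, poissonWeight, div_eq_inv_mul, mul_assoc]

theorem hasSum_mul_poissonWeight_smul_pow (t : ℝ) (g : A) :
    HasSum (fun k : ℕ => ((k : ℝ) * poissonWeight t k) • g ^ k)
      (t • (g * NormedSpace.exp (t • (g - 1)))) := by
  rw [← hasSum_nat_add_iff' 1]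
  simp only [Finset.range_one, Finset.sum_singleton, Nat.cast_zero, zero_mul, zero_smul, sub_zero]
  refine (((hasSum_poissonWeight_smul_pow t g).mul_left g).const_smul t).congr_fun fun k => ?_
  rw [succ_mul_poissonWeight_succ, pow_succ', mul_smul_comm, smul_smul]

end Complete

theorem hasSum_poissonWeight (t : ℝ) : HasSum (poissonWeight t) 1 := by
  simpa using hasSum_poissonWeight_smul_pow t (1 : ℝ)

theorem hasSum_mul_poissonWeight (t : ℝ) :
    HasSum (fun k : ℕ => (k : ℝ) * poissonWeight t k) t := by
  simpa using hasSum_mul_poissonWeight_smul_pow t (1 : ℝ)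

theorem hasSum_sq_mul_poissonWeight (t : ℝ) :
    HasSum (fun k : ℕ => (k : ℝ) ^ 2 * poissonWeight t k) (t * (t + 1)) := by
  rw [← hasSum_nat_add_iff' 1]
  simp only [Finset.range_one, Finset.sum_singleton, Nat.cast_zero, ne_eq, OfNat.ofNat_ne_zero,
    not_false_eq_true, zero_pow, zero_mul, sub_zero]
  refine (((hasSum_mul_poissonWeight t).add (hasSum_poissonWeight t)).mul_left t).congr_fun
    fun k => ?_
  rw [sq, mul_assoc, succ_mul_poissonWeight_succ]
  push_cast
  ring

/-- The `L¹` smoothing bound for Poisson weights, in an arbitrary Banach algebra. -/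
theorem norm_sub_one_mul_exp_le [CompleteSpace A] [NormOneClass A] {g : A} (hg : ‖g‖ ≤ 1)
    {t : ℝ} (ht : 0 < t) :
    ‖(g - 1) * NormedSpace.exp (t • (g - 1))‖ ≤ 1 / √t := by
  set s := √t with hs
  have hs0 : 0 < s := Real.sqrt_pos.2 ht
  have hst : t = s ^ 2 := (Real.sq_sqrt ht.le).symm
  -- Differencing the Poisson weights multiplies them by `k / t - 1`, so the norm is at most the
  -- mean of `|k / t - 1|`.
  have h1 : HasSum (fun k : ℕ => (((k : ℝ) / t - 1) * poissonWeight t k) • g ^ k)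
      ((g - 1) * NormedSpace.exp (t • (g - 1))) := by
    have h := ((hasSum_mul_poissonWeight_smul_pow t g).const_smul t⁻¹).sub
      (hasSum_poissonWeight_smul_pow t g)
    rw [smul_smul, inv_mul_cancel₀ ht.ne', one_smul] at h
    rw [sub_mul, one_mul]
    refine h.congr_fun fun k => ?_
    rw [smul_smul, ← sub_smul]
    congr 1
    ring
  -- `|u| ≤ (s u² + 1 / s) / 2` replaces Cauchy–Schwarz; the variance of `k / t` is `1 / t = 1 /
  -- s²`.
  have h2 : HasSum (fun k : ℕ => (s * ((k : ℝ) / t - 1) ^ 2 + 1 / s) / 2 * poissonWeight t k)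
      (1 / s) := by
    have h := (((hasSum_sq_mul_poissonWeight t).mul_left (s / t ^ 2 / 2)).sub
      ((hasSum_mul_poissonWeight t).mul_left (s / t))).add
      ((hasSum_poissonWeight t).mul_left ((s + 1 / s) / 2))
    have e : s / t ^ 2 / 2 * (t * (t + 1)) - s / t * t + (s + 1 / s) / 2 * 1 = 1 / s := by
      rw [hst]
      field_simp
      ring
    rw [e] at h
    refine h.congr_fun fun k => ?_
    field_simp
    ring
  refine h1.norm_le_of_bounded h2 fun k => ?_
  rw [norm_smul, norm_mul, Real.norm_of_nonneg (poissonWeight_nonneg ht.le k), Real.norm_eq_abs]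
  refine (mul_le_of_le_one_right (by have := poissonWeight_nonneg ht.le k; positivity)
    ((norm_pow_le g k).trans (pow_le_one₀ (norm_nonneg _) hg))).trans ?_
  refine mul_le_mul_of_nonneg_right ?_ (poissonWeight_nonneg ht.le k)
  rw [← sq_abs]
  have := sq_nonneg (s * |(k : ℝ) / t - 1| - 1)
  rw [le_div_iff₀ two_pos, ← sub_nonneg]
  have e : s * |(k : ℝ) / t - 1| ^ 2 + 1 / s - |(k : ℝ) / t - 1| * 2 =
    (s * |(k : ℝ) / t - 1| - 1) ^ 2 / s := by
    field_simp; ring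
  rw [e]; positivity

/-- The weights of the binomial distribution. -/
noncomputable def binomialWeight (K : ℕ) (p : ℝ) (j : ℕ) : ℝ :=
  K.choose j * p ^ j * (1 - p) ^ (K - j)

theorem binomialWeight_nonneg {p : ℝ} (hp : 0 ≤ p) (hp' : p ≤ 1) (K j : ℕ) :
    0 ≤ binomialWeight K p j := by
  have : 0 ≤ 1 - p := by linarith
  unfold binomialWeight; positivity

theorem sum_binomialWeight_smul_pow (K : ℕ) (p : ℝ) (g : A) :
    ∑ j ∈ Finset.range (K + 1), binomialWeight K p j • g ^ j =
      ((1 - p) • (1 : A) + p • g) ^ K := by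
  rw [add_comm ((1 - p) • (1 : A)), add_pow]
  refine Finset.sum_congr rfl fun j _ => ?_
  rw [smul_pow, smul_pow, one_pow, binomialWeight, mul_smul_comm, mul_one, ← nsmul_eq_mul',
    ← Nat.cast_smul_eq_nsmul ℝ, smul_smul, smul_smul]
  congr 1
  ring

theorem sum_mul_binomialWeight_smul_pow (k : ℕ) (p : ℝ) (g : A) :
    ∑ j ∈ Finset.range (k + 2), ((j : ℝ) * binomialWeight (k + 1) p j) • g ^ j =
      (((k : ℝ) + 1) * p) • (g * ((1 - p) • (1 : A) + p • g) ^ k) := by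
  rw [Finset.sum_range_succ', ← sum_binomialWeight_smul_pow, Finset.mul_sum, Finset.smul_sum]
  simp only [Nat.cast_zero, zero_mul, zero_smul, add_zero]
  refine Finset.sum_congr rfl fun j _ => ?_
  rw [mul_smul_comm, smul_smul, ← pow_succ']
  congr 1
  unfold binomialWeight
  have h : ((k + 1).choose (j + 1) : ℝ) * (j + 1) = (k + 1) * k.choose j := by
    exact_mod_cast (Nat.add_one_mul_choose_eq k j).symm
  rw [Nat.add_sub_add_right, Nat.cast_add_one]
  linear_combination p ^ (j + 1) * (1 - p) ^ (k - j) * h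

theorem sum_sq_mul_binomialWeight (K : ℕ) (p : ℝ) :
    ∑ j ∈ Finset.range (K + 1), ((j : ℝ) - K * p) ^ 2 * binomialWeight K p j =
      K * p * (1 - p) := by
  have h := congrArg (Polynomial.eval p) (bernsteinPolynomial.variance ℝ K)
  simp only [Polynomial.eval_finsetSum, bernsteinPolynomial, Polynomial.eval_mul,
    Polynomial.eval_pow, Polynomial.eval_sub, Polynomial.eval_X,
    Polynomial.eval_natCast, Polynomial.eval_one, nsmul_eq_mul] at h
  rw [← h]
  refine Finset.sum_congr rfl fun j _ => ?_
  unfold binomialWeight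
  ring

theorem sum_binomialWeight (K : ℕ) (p : ℝ) :
    ∑ j ∈ Finset.range (K + 1), binomialWeight K p j = 1 := by
  simpa using sum_binomialWeight_smul_pow K p (1 : ℝ)

/-- The `L¹` smoothing bound for binomial weights, in an arbitrary Banach algebra. -/
theorem norm_sub_one_mul_pow_le [NormOneClass A] {g : A} (hg : ‖g‖ ≤ 1) {p : ℝ} (hp : 0 < p)
    (hp' : p < 1) (k : ℕ) :
    ‖(g - 1) * ((1 - p) • (1 : A) + p • g) ^ k‖ ≤ 1 / √((k + 1) * p * (1 - p)) := by
  have hq : 0 < 1 - p := by linarith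
  have hv : 0 < ((k : ℝ) + 1) * p * (1 - p) := by positivity
  set v := ((k : ℝ) + 1) * p * (1 - p)
  set s := √v
  have hs0 : 0 < s := Real.sqrt_pos.2 hv
  have hsv : v = s ^ 2 := (Real.sq_sqrt hv.le).symm
  -- Differences of binomial weights of order `k` are centred weights of order `k + 1`, divided by
  -- the variance `v`; the first absolute central moment is then at most `√v`.
  have h1 : v • ((g - 1) * ((1 - p) • (1 : A) + p • g) ^ k) =
      ∑ j ∈ Finset.range (k + 2),
        (((j : ℝ) - ((k + 1 : ℕ) : ℝ) * p) * binomialWeight (k + 1) p j) • g ^ j := by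
    simp only [sub_mul, sub_smul, Finset.sum_sub_distrib]
    rw [sum_mul_binomialWeight_smul_pow]
    simp only [mul_assoc _ p, mul_smul, ← Finset.smul_sum]
    rw [sum_binomialWeight_smul_pow, pow_succ]
    simp only [v, mul_smul, Nat.cast_add_one, ← smul_sub]
    congr 2
    simp only [Algebra.smul_def, map_sub, map_one]
    ring
  have h2 : v * ‖(g - 1) * ((1 - p) • (1 : A) + p • g) ^ k‖ ≤ s := by
    rw [← Real.norm_of_nonneg hv.le, ← norm_smul, h1]
    have h3 : ∑ j ∈ Finset.range (k + 2),
        ((((j : ℝ) - ((k + 1 : ℕ) : ℝ) * p) ^ 2 / s + s) / 2 * binomialWeight (k + 1) p j) = s := by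
      simp only [add_div, add_mul, Finset.sum_add_distrib, ← Finset.mul_sum, sum_binomialWeight]
      simp only [div_mul_eq_mul_div, ← Finset.sum_div, sum_sq_mul_binomialWeight]
      rw [Nat.cast_add_one, show ((k : ℝ) + 1) * p * (1 - p) = s ^ 2 from hsv]
      field_simp
      norm_num
    rw [← h3]
    refine norm_sum_le_of_le _ fun j _ => ?_
    have hb := binomialWeight_nonneg hp.le hp'.le (k + 1) j
    rw [norm_smul, norm_mul, Real.norm_of_nonneg hb, Real.norm_eq_abs]
    refine (mul_le_of_le_one_right (by positivity)
      ((norm_pow_le g j).trans (pow_le_one₀ (norm_nonneg _) hg))).trans ?_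
    refine mul_le_mul_of_nonneg_right ?_ hb
    set u := |(j : ℝ) - ((k + 1 : ℕ) : ℝ) * p| with hu
    rw [← sq_abs, ← hu, le_div_iff₀ two_pos, ← sub_nonneg]
    have e : u ^ 2 / s + s - u * 2 = (u - s) ^ 2 / s := by
      field_simp; ring
    rw [e]; positivity
  rw [hsv] at h2
  rw [le_div_iff₀ hs0]
  nlinarith

end Smoothing

/-! ### Transfer of smoothing to mixtures. -/

section Mixture

variable {A : Type*} [NormedCommRing A] [NormedAlgebra ℝ A]

/-- Dividing by `i + 1` turns binomial weights of order `k` into shifted weights of order `k + 1`,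
whose total is at most 1. -/
theorem sum_binomialWeight_div_succ_le (k : ℕ) {l : ℝ} (hl : 0 < l) (hl' : l ≤ 1) :
    ∑ i ∈ Finset.range (k + 1), binomialWeight k l i / (i + 1) ≤ 1 / ((k + 1) * l) := by
  have h : ∀ i, binomialWeight k l i / (i + 1) =
      binomialWeight (k + 1) l (i + 1) / ((k + 1) * l) := fun i => by
    have h : ((k + 1).choose (i + 1) : ℝ) * (i + 1) = (k + 1) * k.choose i := by
      exact_mod_cast (Nat.add_one_mul_choose_eq k i).symm
    unfold binomialWeight
    rw [Nat.add_sub_add_right, div_eq_div_iff (by positivity) (by positivity)]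
    linear_combination -(l ^ (i + 1) * (1 - l) ^ (k - i)) * h
  rw [Finset.sum_congr rfl fun i _ => h i, ← Finset.sum_div]
  gcongr
  rw [← sum_binomialWeight (k + 1) l, Finset.sum_range_succ' _ (k + 1)]
  exact le_add_of_nonneg_right (binomialWeight_nonneg hl.le hl' _ _)

/-- Smoothing by the powers of a component `a` is inherited by the powers of a mixture. -/
theorem norm_mul_pow_le_of_mixture {u a F : A} {l c : ℝ} (hl : 0 < l) (hl' : l ≤ 1)
    [NormOneClass A] (hb : ‖F - l • a‖ ≤ 1 - l)
    (hu : ∀ i : ℕ, ‖u * a ^ i‖ ≤ c / (i + 1)) (k : ℕ) :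
    ‖u * F ^ k‖ ≤ c / ((k + 1) * l) := by
  have hc : 0 ≤ c := by simpa using (norm_nonneg _).trans (hu 0)
  -- Binomial expansion of `F = l a + (F - l a)`: the number of factors `a` behaves like a binomial
  -- variable with parameter `l`.
  have h : u * F ^ k = ∑ i ∈ Finset.range (k + 1),
      (k.choose i * l ^ i : ℝ) • (u * a ^ i * (F - l • a) ^ (k - i)) := by
    conv_lhs => rw [← add_sub_cancel (l • a) F, add_pow, Finset.mul_sum]
    refine Finset.sum_congr rfl fun i _ => ?_
    rw [smul_pow]
    simp only [Algebra.smul_def, map_mul, map_natCast]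
    ring
  rw [h]
  calc _ ≤ ∑ i ∈ Finset.range (k + 1), c * (binomialWeight k l i / (i + 1)) := by
        refine norm_sum_le_of_le _ fun i _ => ?_
        rw [norm_smul, Real.norm_of_nonneg (by positivity)]
        calc (k.choose i * l ^ i : ℝ) * ‖u * a ^ i * (F - l • a) ^ (k - i)‖
            ≤ (k.choose i * l ^ i : ℝ) * (c / (i + 1) * (1 - l) ^ (k - i)) := by
              gcongr
              refine (norm_mul_le _ _).trans ?_
              gcongr
              · exact hu i
              · exact (norm_pow_le _ _).trans (by gcongr)
          _ = c * (binomialWeight k l i / (i + 1)) := by unfold binomialWeight; ring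
    _ ≤ c * (1 / ((k + 1) * l)) := by
        rw [← Finset.mul_sum]
        gcongr
        exact sum_binomialWeight_div_succ_le k hl hl'
    _ = _ := by ring

end Mixture

/-! ### Smoothing of a symmetric pair of atoms. -/

section Law

variable {A G : Type*} [NormedCommRing A] [NormedAlgebra ℝ A]
  {T : G → A} {p : G → ℝ} {F : A}

theorem norm_le_of_hasSum_smul (hT : ∀ x, ‖T x‖ ≤ 1) {a : G → ℝ} {X : A} {b : ℝ}
    (ha : ∀ x, 0 ≤ a x) (hb : HasSum a b) (hX : HasSum (fun x => a x • T x) X) : ‖X‖ ≤ b := by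
  refine hX.norm_le_of_bounded hb fun x => ?_
  rw [norm_smul, Real.norm_of_nonneg (ha x)]
  exact mul_le_of_le_one_right (ha x) (hT x)

theorem norm_sub_sum_smul_le (hT : ∀ x, ‖T x‖ ≤ 1) (hp : HasSum p 1)
    (hF : HasSum (fun x => p x • T x) F) (hp0 : ∀ x, 0 ≤ p x) (s : Finset G) (v : G → ℝ)
    (hv : ∀ x ∈ s, v x ≤ p x) :
    ‖F - ∑ x ∈ s, v x • T x‖ ≤ 1 - ∑ x ∈ s, v x := by
  classical
  have h1 : HasSum (fun x => if x ∈ s then v x else 0) (∑ x ∈ s, v x) := by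
    have h := hasSum_sum_of_ne_finset_zero (f := fun x => if x ∈ s then v x else 0) (s := s)
      (L := .unconditional G) (fun b hb => by simp [hb])
    rwa [Finset.sum_congr rfl fun x hx => if_pos hx] at h
  have h2 : HasSum (fun x => (if x ∈ s then v x else 0) • T x) (∑ x ∈ s, v x • T x) := by
    have h := hasSum_sum_of_ne_finset_zero (f := fun x => (if x ∈ s then v x else 0) • T x)
      (s := s) (L := .unconditional G) (fun b hb => by simp [hb])
    rwa [Finset.sum_congr rfl fun x hx => by rw [if_pos hx]] at h
  refine norm_le_of_hasSum_smul hT (a := fun x => p x - if x ∈ s then v x else 0)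
    (fun x => ?_) (hp.sub h1) ?_
  · split_ifs with h
    · exact sub_nonneg.2 (hv x h)
    · simpa using hp0 x
  · simpa only [sub_smul] using hF.sub h2

variable [NormOneClass A] [AddCommGroup G]

/-- Averaging the expansion of `F - 1` with its reflection writes it as the sum of `(p x / 2)(T x +
T (-x) - 2)`. Each term is bounded either trivially, the bracket having norm at most 4, or by the
hypothesis `h`. -/
theorem norm_sub_one_mul_le_tsum_min (hT : ∀ x, ‖T x‖ ≤ 1) (hT0 : T 0 = 1)
    (hp : HasSum p 1) (hF : HasSum (fun x => p x • T x) F) (hp0 : ∀ x, 0 ≤ p x)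
    (hsymm : ∀ x, p (-x) = p x) {Y : A} (hY : ‖Y‖ ≤ 1) {c : ℝ} (hc : 0 ≤ c)
    (h : ∀ x, x ≠ 0 → p x * ‖(T x + T (-x) - 2) * Y‖ ≤ c) :
    ‖(F - 1) * Y‖ ≤ ∑' x : {x : G // x ≠ 0}, min (2 * p x) (c / 2) := by
  have hpT : HasSum (fun x => p x • (1 : A)) (1 : A) := by simpa using hp.smul_const (1 : A)
  have h1 : HasSum (fun x => p x • (T x - 1)) (F - 1) := by
    simpa only [smul_sub] using hF.sub hpT
  have h2 : HasSum (fun x => p x • (T (-x) - 1)) (F - 1) := by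
    have := (Equiv.neg G).hasSum_iff.2 h1
    simpa [Function.comp_def, hsymm] using this
  have h3 : HasSum (fun x => (p x / 2) • ((T x + T (-x) - 2) * Y)) ((F - 1) * Y) := by
    have h4 := ((h1.add h2).const_smul (1 / 2 : ℝ)).mul_right Y
    have e : (1 / 2 : ℝ) • (F - 1 + (F - 1)) = F - 1 := by
      rw [← two_smul ℝ (F - 1), smul_smul]; norm_num
    rw [e] at h4
    refine h4.congr_fun fun x => ?_
    rw [← smul_add, smul_smul, smul_mul_assoc]
    congr 2 <;> ring
  have h5 : HasSum (fun x : {x : G // x ≠ 0} => (p x / 2) • ((T x + T (-x) - 2) * Y))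
      ((F - 1) * Y) := by
    refine (hasSum_subtype_iff_of_support_subset (s := {x : G | x ≠ 0}) fun x hx => ?_).2 h3
    rintro rfl
    exact hx (by simp [hT0, one_add_one_eq_two])
  have hsum : Summable fun x : {x : G // x ≠ 0} => min (2 * p x) (c / 2) := by
    refine Summable.of_nonneg_of_le (fun x => le_min (by have := hp0 x; positivity) (by positivity))
      (fun x => min_le_left _ _) ((hp.summable.subtype _).mul_left 2)
  refine h5.norm_le_of_bounded hsum.hasSum fun x => ?_
  have hpx := hp0 x
  rw [norm_smul, Real.norm_of_nonneg (by positivity)]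
  refine le_min ?_ ?_
  · have : ‖(T x + T (-x) - 2) * Y‖ ≤ 4 := by
      refine (norm_mul_le _ _).trans ?_
      have h6 : ‖T x + T (-x) - 2‖ ≤ 4 := by
        have e : T x + T (-x) - 2 = T x + T (-x) - 1 - 1 := by ring
        have h7 := norm_sub_le (T x + T (-x) - 1) 1
        have h8 := norm_sub_le (T x + T (-x)) 1
        have h9 := norm_add_le (T x) (T (-x))
        rw [norm_one] at h7 h8
        rw [e]
        linarith [hT x, hT (-x)]
      calc ‖T x + T (-x) - 2‖ * ‖Y‖ ≤ 4 * 1 := by gcongr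
        _ = 4 := mul_one _
    nlinarith
  · linarith [h x x.2]

/-- `F` contains, with weight `2 * p 0 * p x`, the product `a` of the two lazy steps `(1 + T x) / 2`
and `(1 + T (-x)) / 2`. Powers of `a` smooth both factors of `T x + T (-x) - 2`, and the mixture
bound carries this over to `F`. -/
theorem mul_norm_pair_mul_pow_le (hT : ∀ x, ‖T x‖ ≤ 1) (hinv : ∀ x, T x * T (-x) = 1)
    (hT0 : T 0 = 1)
    (hp : HasSum p 1) (hF : HasSum (fun x => p x • T x) F) (hp0 : ∀ x, 0 ≤ p x)
    (hsymm : ∀ x, p (-x) = p x) (hq : 0 < p 0) {x : G} (hx : x ≠ -x) (hx0 : x ≠ 0) (k : ℕ) :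
    p x * ‖(T x + T (-x) - 2) * F ^ k‖ ≤ 2 / ((k + 1) * p 0) := by
  rcases (hp0 x).eq_or_lt with h0 | h0
  · rw [← h0, zero_mul]; positivity
  classical
  have hp1 : ∀ y, p y ≤ 1 := fun y => le_hasSum hp y fun z _ => hp0 z
  -- With this weight `l • a` has mass `p 0 * p x` at `0` and `p 0 * p x / 2` at `x` and at `-x`,
  -- all within the masses of `F`.
  set l := 2 * p 0 * p x with hl
  have hl0 : 0 < l := by positivity
  have hn0 : (0 : G) ∉ ({x, -x} : Finset G) := by simp [hx0.symm, hx0]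
  set a : A := ((1 - (1 / 2 : ℝ)) • (1 : A) + (1 / 2 : ℝ) • T x) *
    ((1 - (1 / 2 : ℝ)) • (1 : A) + (1 / 2 : ℝ) • T (-x)) with ha
  have ha' : l • a = (p 0 * p x) • T 0 + ((l / 4) • T x + (l / 4) • T (-x)) := by
    rw [ha, hT0, hl]
    simp only [add_mul, mul_add, smul_mul_smul_comm, one_mul, mul_one, hinv]
    module
  have hsum : ‖F - l • a‖ ≤ 1 - l := by
    have h := norm_sub_sum_smul_le hT hp hF hp0 (insert 0 {x, -x})
      (fun y => if y = 0 then p 0 * p x else l / 4) (fun y hy => ?_)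
    · rw [Finset.sum_insert hn0, Finset.sum_insert hn0, Finset.sum_pair hx, Finset.sum_pair hx,
        if_pos rfl, if_neg hx0, if_neg (neg_ne_zero.2 hx0), ← ha'] at h
      linarith
    · have h1 := hp1 0
      have h2 := hp1 x
      simp only [Finset.mem_insert, Finset.mem_singleton] at hy
      rcases hy with rfl | rfl | rfl
      · rw [if_pos rfl]; nlinarith
      · rw [if_neg hx0]; nlinarith
      · rw [if_neg (neg_ne_zero.2 hx0), hsymm]; nlinarith
  have hl1 : l ≤ 1 := by linarith [norm_nonneg (F - l • a)]
  have hhalf : ∀ i : ℕ, 1 / √(((i : ℝ) + 1) * (1 / 2) * (1 - 1 / 2)) *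
      (1 / √(((i : ℝ) + 1) * (1 / 2) * (1 - 1 / 2))) = 4 / (i + 1) := fun i => by
    rw [← mul_div_mul_comm, Real.mul_self_sqrt (by norm_num; positivity)]
    field_simp
    norm_num
  have h := norm_mul_pow_le_of_mixture (u := T x + T (-x) - 2) (c := 4) hl0 hl1 hsum
    (fun i => ?_) k
  · calc p x * ‖(T x + T (-x) - 2) * F ^ k‖ ≤ p x * (4 / ((k + 1) * l)) := by gcongr
      _ = 2 / ((k + 1) * p 0) := by rw [hl]; field_simp; norm_num
  · have e : (T x + T (-x) - 2) * a ^ i =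
        -(((T x - 1) * ((1 - (1 / 2 : ℝ)) • (1 : A) + (1 / 2 : ℝ) • T x) ^ i) *
          ((T (-x) - 1) * ((1 - (1 / 2 : ℝ)) • (1 : A) + (1 / 2 : ℝ) • T (-x)) ^ i)) := by
      rw [ha, mul_pow]
      linear_combination (((1 - (1 / 2 : ℝ)) • (1 : A) + (1 / 2 : ℝ) • T x) ^ i *
        ((1 - (1 / 2 : ℝ)) • (1 : A) + (1 / 2 : ℝ) • T (-x)) ^ i) * hinv x
    rw [e, norm_neg, ← hhalf]
    refine (norm_mul_le _ _).trans (mul_le_mul ?_ ?_ (norm_nonneg _) (by positivity))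
    · exact norm_sub_one_mul_pow_le (hT x) (by norm_num) (by norm_num) i
    · exact norm_sub_one_mul_pow_le (hT (-x)) (by norm_num) (by norm_num) i

variable [CompleteSpace A]

/-- The exponential factors into independent Poisson parts for the jumps `x` and `-x`, which smooth
`T x - 1` and `T (-x) - 1` respectively, and a contraction carrying all other jumps. The condition
`x ≠ -x` makes the pair two atoms of total mass `2 * p x`. -/
theorem mul_norm_pair_mul_exp_le (hT : ∀ x, ‖T x‖ ≤ 1) (hinv : ∀ x, T x * T (-x) = 1)
    (hp : HasSum p 1) (hF : HasSum (fun x => p x • T x) F) (hp0 : ∀ x, 0 ≤ p x)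
    (hsymm : ∀ x, p (-x) = p x) {x : G} (hx : x ≠ -x) {t : ℝ} (ht : 0 < t) :
    p x * ‖(T x + T (-x) - 2) * NormedSpace.exp (t • (F - 1))‖ ≤ 1 / t := by
  rcases (hp0 x).eq_or_lt with h0 | h0
  · rw [← h0, zero_mul]; positivity
  classical
  have htp : 0 < t * p x := by positivity
  have hrest : ‖F - (p x • T x + p x • T (-x))‖ ≤ 1 - 2 * p x := by
    have h := norm_sub_sum_smul_le hT hp hF hp0 {x, -x} p (fun _ _ => le_rfl)
    rw [Finset.sum_pair hx, Finset.sum_pair hx, hsymm] at h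
    linarith
  have e1 : t • (F - 1) = (t * p x) • (T x - 1) + (t * p x) • (T (-x) - 1) +
      (t • (F - (p x • T x + p x • T (-x))) - (t * (1 - 2 * p x)) • (1 : A)) := by
    simp only [Algebra.smul_def, map_mul, map_sub, map_one, map_ofNat]
    ring
  have h3 : ‖NormedSpace.exp
      (t • (F - (p x • T x + p x • T (-x))) - (t * (1 - 2 * p x)) • (1 : A))‖ ≤ 1 := by
    refine norm_exp_sub_smul_one_le ?_
    rw [norm_smul, Real.norm_of_nonneg ht.le]
    gcongr
  have h1 := norm_sub_one_mul_exp_le (hT x) htp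
  have h2 := norm_sub_one_mul_exp_le (hT (-x)) htp
  have e2 : (T x + T (-x) - 2) * NormedSpace.exp (t • (F - 1)) =
      -(((T x - 1) * NormedSpace.exp ((t * p x) • (T x - 1))) *
        ((T (-x) - 1) * NormedSpace.exp ((t * p x) • (T (-x) - 1))) *
        NormedSpace.exp
          (t • (F - (p x • T x + p x • T (-x))) - (t * (1 - 2 * p x)) • (1 : A))) := by
    rw [e1, exp_add', exp_add']
    linear_combination (NormedSpace.exp ((t * p x) • (T x - 1)) *
      NormedSpace.exp ((t * p x) • (T (-x) - 1)) * NormedSpace.exp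
          (t • (F - (p x • T x + p x • T (-x))) - (t * (1 - 2 * p x)) • (1 : A))) * hinv x
  calc p x * ‖(T x + T (-x) - 2) * NormedSpace.exp (t • (F - 1))‖
      ≤ p x * (1 / √(t * p x) * (1 / √(t * p x)) * 1) := by
        rw [e2, norm_neg]
        gcongr
        refine (norm_mul_le _ _).trans (mul_le_mul ?_ h3 (norm_nonneg _) (by positivity))
        exact (norm_mul_le _ _).trans (mul_le_mul h1 h2 (norm_nonneg _) (by positivity))
    _ = 1 / t := by
        rw [mul_one, ← mul_div_mul_comm, Real.mul_self_sqrt htp.le]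
        field_simp

end Law

/-! ### The function `δ` for a family of weights. -/

section TruncatedMass

variable {G : Type*} [AddCommGroup G] {p : G → ℝ}

/-- The sum `∑_{x ≠ 0} min(1, y e p x)`. -/
noncomputable def truncatedMass (p : G → ℝ) (y : ℝ) : ℝ :=
  ∑' x : {x : G // x ≠ 0}, min 1 (y * Real.exp 1 * p x.1)

theorem summable_truncatedMass (hp : Summable p) (hp0 : ∀ x, 0 ≤ p x) {y : ℝ} (hy : 0 ≤ y) :
    Summable fun x : {x : G // x ≠ 0} => min 1 (y * Real.exp 1 * p x.1) :=
  Summable.of_nonneg_of_le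
    (fun x => le_min zero_le_one (by have := hp0 x; positivity))
    (fun _ => min_le_right _ _) ((hp.subtype _).mul_left _)

theorem truncatedMass_nonneg (hp0 : ∀ x, 0 ≤ p x) {y : ℝ} (hy : 0 ≤ y) :
    0 ≤ truncatedMass p y :=
  tsum_nonneg fun x => le_min zero_le_one (by have := hp0 x; positivity)

/-- For `y ≥ 1/2` one has `y * e ≥ 1`, so each truncated term is at least `p x`. -/
theorem one_sub_le_truncatedMass (hp : HasSum p 1) (hp0 : ∀ x, 0 ≤ p x) {y : ℝ}
    (hy : 1 / 2 ≤ y) : 1 - p 0 ≤ truncatedMass p y := by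
  have he : 2 ≤ Real.exp 1 := by linarith [Real.exp_one_gt_d9]
  have h1 : HasSum (fun x : {x : G // x ≠ 0} => p x) (1 - p 0) := by
    have h2 := (hasSum_subtype_iff_indicator (f := p) (s := ({0} : Set G)) (a := p 0)).1 (by
      simpa using hasSum_unique (p ∘ Subtype.val : ({0} : Set G) → ℝ))
    have h3 := hp.sub h2
    refine (hasSum_subtype_iff_indicator (f := p) (s := {x : G | x ≠ 0})).2 ?_
    refine h3.congr_fun fun x => ?_
    by_cases hx : x = 0 <;> simp [hx, Set.indicator]
  refine hasSum_le (fun x => ?_) h1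
    (summable_truncatedMass hp.summable hp0 (by linarith : 0 ≤ y)).hasSum
  have hx0 := hp0 x
  refine le_min (le_hasSum hp _ fun z _ => hp0 z) (le_mul_of_one_le_left hx0 ?_)
  nlinarith

end TruncatedMass

/-! ### Bounds in terms of `δ`, and the estimate in a commutative algebra. -/

section Law

/-- The four copies of `R * Y` may be estimated by different bounds; this is what mixes `δ(n/2)`,
`δ(nq)` and a factor free of `δ`. -/
theorem norm_pow_four_mul_le {B : Type*} [NormedCommRing B] [NormOneClass B] {R Y Z : B}
    {a b c : ℝ} (hZ : ‖Z‖ ≤ 1) (ha : ‖R * Y‖ ≤ a) (hb : ‖R * Y‖ ≤ b) (hc : ‖R * Y‖ ≤ c) :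
    ‖Y ^ 4 * Z * R ^ 4‖ ≤ a ^ 2 * b * c := by
  have e : Y ^ 4 * Z * R ^ 4 = (R * Y) ^ 2 * (R * Y) * (R * Y) * Z := by ring
  have h0 := norm_nonneg (R * Y)
  have hb0 := h0.trans hb
  have hc0 := h0.trans hc
  rw [e]
  calc _ ≤ ‖R * Y‖ ^ 2 * ‖R * Y‖ * ‖R * Y‖ * ‖Z‖ := by
        refine (norm_mul_le _ _).trans ?_
        gcongr
        refine (norm_mul_le _ _).trans ?_
        gcongr
        refine (norm_mul_le _ _).trans ?_
        gcongr
        exact norm_pow_le _ _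
    _ ≤ a ^ 2 * b * c * 1 := by gcongr
    _ = _ := mul_one _

variable {A G : Type*} [NormedCommRing A] [NormedAlgebra ℝ A] [AddCommGroup G]
  {T : G → A} {p : G → ℝ} {F : A}

theorem norm_sub_smul_one_le (hT : ∀ x, ‖T x‖ ≤ 1) (hT0 : T 0 = 1)
    (hp : HasSum p 1) (hF : HasSum (fun x => p x • T x) F) (hp0 : ∀ x, 0 ≤ p x) :
    ‖F - p 0 • (1 : A)‖ ≤ 1 - p 0 := by
  simpa [hT0] using norm_sub_sum_smul_le hT hp hF hp0 {0} p (fun _ _ => le_rfl)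

variable [NormOneClass A]

/-- The conditions on `K` are exactly `c / 2 ≤ K * 1` and `2 * p x ≤ K * (y * e * p x)`, which
dominate the two entries of the minimum. -/
theorem norm_sub_one_mul_le_truncatedMass (hT : ∀ x, ‖T x‖ ≤ 1) (hT0 : T 0 = 1)
    (hp : HasSum p 1) (hF : HasSum (fun x => p x • T x) F) (hp0 : ∀ x, 0 ≤ p x)
    (hsymm : ∀ x, p (-x) = p x) {Y : A} (hY : ‖Y‖ ≤ 1) {c K y : ℝ} (hc : 0 ≤ c)
    (h : ∀ x, x ≠ 0 → p x * ‖(T x + T (-x) - 2) * Y‖ ≤ c) (hy : 0 ≤ y) (hK : c / 2 ≤ K)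
    (hKy : 2 ≤ K * (y * Real.exp 1)) :
    ‖(F - 1) * Y‖ ≤ K * truncatedMass p y := by
  have hK0 : 0 ≤ K := by linarith
  refine (norm_sub_one_mul_le_tsum_min hT hT0 hp hF hp0 hsymm hY hc h).trans ?_
  rw [truncatedMass, ← tsum_mul_left]
  have hs := (summable_truncatedMass hp.summable hp0 hy).mul_left K
  have hle : ∀ x : {x : G // x ≠ 0}, min (2 * p x) (c / 2) ≤
      K * min 1 (y * Real.exp 1 * p x.1) := fun x => by
    rw [mul_min_of_nonneg _ _ hK0, mul_one, ← mul_assoc]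
    exact le_min ((min_le_right _ _).trans hK)
      ((min_le_left _ _).trans (mul_le_mul_of_nonneg_right hKy (hp0 x)))
  exact (Summable.of_nonneg_of_le
    (fun x => le_min (by have := hp0 x; positivity) (by positivity)) hle hs).tsum_le_tsum hle hs

/-- The smoothing bound for powers that uses only the atom at `0`. -/
theorem norm_sub_one_mul_pow_le_of_atom (hT : ∀ x, ‖T x‖ ≤ 1) (hT0 : T 0 = 1)
    (hp : HasSum p 1) (hF : HasSum (fun x => p x • T x) F) (hp0 : ∀ x, 0 ≤ p x)
    (hq : 0 < p 0) (hq1 : p 0 < 1) (m : ℕ) :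
    ‖(F - 1) * F ^ m‖ ≤ 1 / √((m + 1) * p 0) := by
  -- `F = (1 - P) + P g` with `‖g‖ ≤ 1`, so powers of `F` are binomial mixtures of powers of `g`.
  set P := 1 - p 0 with hP
  have hP0 : 0 < P := by linarith
  have hP1 : P < 1 := by linarith
  set g := P⁻¹ • (F - p 0 • (1 : A)) with hg
  have hg1 : ‖g‖ ≤ 1 := by
    rw [hg, norm_smul, norm_inv, Real.norm_of_nonneg hP0.le, inv_mul_le_one₀ hP0]
    exact norm_sub_smul_one_le hT hT0 hp hF hp0
  have hPg : P • g = F - p 0 • (1 : A) := by rw [hg, smul_inv_smul₀ hP0.ne']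
  have h1 : (1 - P) • (1 : A) + P • g = F := by
    rw [hPg, hP, sub_sub_cancel, add_sub_cancel]
  have h2 : F - 1 = P • (g - 1) := by
    rw [smul_sub, hPg, hP, sub_smul, one_smul]; abel
  have h := norm_sub_one_mul_pow_le hg1 hP0 hP1 m
  rw [h1] at h
  rw [h2, smul_mul_assoc, norm_smul, Real.norm_of_nonneg hP0.le]
  calc P * ‖(g - 1) * F ^ m‖ ≤ P * (1 / √((m + 1) * P * (1 - P))) := by gcongr
    _ ≤ 1 / √((m + 1) * p 0) := by
      have e : ((m : ℝ) + 1) * P * (1 - P) = P * ((m + 1) * p 0) := by rw [hP]; ring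
      have hv : 0 < ((m : ℝ) + 1) * p 0 := by positivity
      rw [e, mul_one_div, div_le_div_iff₀ (Real.sqrt_pos.2 (by positivity))
        (Real.sqrt_pos.2 hv), one_mul]
      refine Real.le_sqrt_of_sq_le ?_
      rw [mul_pow, Real.sq_sqrt hv.le]
      gcongr
      nlinarith

variable [CompleteSpace A]

/-- A crude bound without smoothing, meant for small `n`: `‖F - 1‖ ≤ 2 (1 - q)` and `1 - q ≤
δ(n/2)`. -/
theorem norm_pow_sub_exp_pow_le_mul_sq (hT : ∀ x, ‖T x‖ ≤ 1) (hT0 : T 0 = 1)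
    (hp : HasSum p 1) (hF : HasSum (fun x => p x • T x) F) (hp0 : ∀ x, 0 ≤ p x)
    (hq1 : p 0 ≤ 1) {n : ℕ} (hn : 1 ≤ n) :
    ‖F ^ n - NormedSpace.exp (F - 1) ^ n‖ / 2 ≤ n * truncatedMass p ((n : ℝ) / 2) ^ 2 := by
  have hF1 : ‖F‖ ≤ 1 := norm_le_of_hasSum_smul hT hp0 hp hF
  have h1 := norm_pow_sub_exp_pow_le hF1 n
  have h2 : ‖F - 1‖ ≤ 2 * (1 - p 0) := by
    have e : F - 1 = (F - p 0 • (1 : A)) - (1 - p 0) • (1 : A) := by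
      rw [sub_smul, one_smul]; abel
    rw [e]
    refine (norm_sub_le _ _).trans ?_
    rw [norm_smul, norm_one, mul_one, Real.norm_of_nonneg (by linarith)]
    linarith [norm_sub_smul_one_le hT hT0 hp hF hp0]
  have h3 : ‖(F - 1) ^ 2‖ ≤ (2 * (1 - p 0)) ^ 2 := (norm_pow_le _ _).trans (by gcongr)
  have hn' : (1 : ℝ) ≤ n := by exact_mod_cast hn
  have h4 := one_sub_le_truncatedMass hp hp0 (y := (n : ℝ) / 2) (by linarith)
  have h5 : (1 - p 0) ^ 2 ≤ truncatedMass p ((n : ℝ) / 2) ^ 2 := by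
    have : 0 ≤ 1 - p 0 := by linarith
    gcongr
  nlinarith

theorem norm_exp_pow_mul_sq_le (hT : ∀ x, ‖T x‖ ≤ 1) (hinv : ∀ x, T x * T (-x) = 1)
    (hT0 : T 0 = 1) (hneg : ∀ x : G, x ≠ 0 → x ≠ -x)
    (hp : HasSum p 1) (hF : HasSum (fun x => p x • T x) F) (hp0 : ∀ x, 0 ≤ p x)
    (hsymm : ∀ x, p (-x) = p x) {n : ℕ} (hn : 4 ≤ n) :
    ‖NormedSpace.exp (F - 1) ^ (n - 1) * (F - 1) ^ 2‖ ≤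
      (4 / (Real.exp 1 * n) * truncatedMass p ((n : ℝ) / 2)) ^ 2 := by
  have hF1 : ‖F‖ ≤ 1 := norm_le_of_hasSum_smul hT hp0 hp hF
  have hn' : (4 : ℝ) ≤ n := by exact_mod_cast hn
  have ht : 0 < ((n : ℝ) - 1) / 2 := by linarith
  set Y := NormedSpace.exp ((((n : ℝ) - 1) / 2) • (F - 1)) with hY
  have he : NormedSpace.exp (F - 1) ^ (n - 1) = Y * Y := by
    rw [← exp_natCast_smul, hY, ← exp_add', ← add_smul, add_halves, Nat.cast_sub (by omega),
      Nat.cast_one]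
  -- `K` is the least value with `K * (n / 2) * e = 2`, which yields the sharp constant. The other
  -- condition, `1 / (n - 1) ≤ K`, reads `e * n ≤ 4 * (n - 1)` and holds from `n = 4` on.
  have h := norm_sub_one_mul_le_truncatedMass hT hT0 hp hF hp0 hsymm (Y := Y)
    (c := 1 / (((n : ℝ) - 1) / 2)) (K := 4 / (Real.exp 1 * n)) (y := (n : ℝ) / 2)
    (norm_exp_smul_sub_one_le hF1 ht.le) (by positivity)
    (fun x hx => mul_norm_pair_mul_exp_le hT hinv hp hF hp0 hsymm (hneg x hx) ht)
    (by positivity) ?_ (le_of_eq (by field_simp; norm_num))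
  · rw [he, show Y * Y * (F - 1) ^ 2 = ((F - 1) * Y) ^ 2 by ring]
    exact (norm_pow_le _ _).trans (by gcongr)
  · have h1 : (0 : ℝ) < n - 1 := by linarith
    have e : 1 / (((n : ℝ) - 1) / 2) / 2 = 1 / (n - 1) := by field_simp
    rw [e, div_le_div_iff₀ h1 (by positivity)]
    nlinarith [Real.exp_one_lt_d9]

theorem norm_mixed_pow_mul_pow_four_le (hT : ∀ x, ‖T x‖ ≤ 1) (hinv : ∀ x, T x * T (-x) = 1)
    (hT0 : T 0 = 1) (hneg : ∀ x : G, x ≠ 0 → x ≠ -x)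
    (hp : HasSum p 1) (hF : HasSum (fun x => p x • T x) F) (hp0 : ∀ x, 0 ≤ p x)
    (hsymm : ∀ x, p (-x) = p x) (hq : 0 < p 0) (hq1 : p 0 < 1) {n : ℕ} (hn : 16 ≤ n)
    {j : ℕ} (hj : j + 2 ≤ n) :
    ‖F ^ j * NormedSpace.exp (F - 1) ^ (n - 2 - j) * (F - 1) ^ 4‖ ≤
      (32 / (n * p 0) * truncatedMass p ((n : ℝ) / 2)) ^ 2 *
        (32 / (n * p 0) * truncatedMass p (n * p 0)) * √(32 / (n * p 0)) := by
  have hF1 : ‖F‖ ≤ 1 := norm_le_of_hasSum_smul hT hp0 hp hF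
  have hn' : (16 : ℝ) ≤ n := by exact_mod_cast hn
  set E := NormedSpace.exp (F - 1) with hE
  have hE1 : ‖E‖ ≤ 1 := by simpa using norm_exp_smul_sub_one_le hF1 zero_le_one
  have hFk : ∀ k, ‖F ^ k‖ ≤ 1 := fun k => (norm_pow_le _ _).trans (pow_le_one₀ (norm_nonneg _) hF1)
  have hEk : ∀ k, ‖E ^ k‖ ≤ 1 := fun k => (norm_pow_le _ _).trans (pow_le_one₀ (norm_nonneg _) hE1)
  -- One of the exponents `j` and `n - 2 - j` is at least `4 * m`, so a share of `m` is available
  -- for each of the four factors `F - 1`.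
  obtain ⟨m, hm, hm1, hm2⟩ : ∃ m : ℕ, 1 ≤ m ∧ n ≤ 32 * m ∧ 16 * m ≤ n :=
    ⟨n / 16, by omega, by omega, by omega⟩
  have hm' : (n : ℝ) ≤ 32 * m := by exact_mod_cast hm1
  have hm0 : (0 : ℝ) < m := by exact_mod_cast hm
  have hc : 2 / (m * p 0) ≤ 64 / (n * p 0) := by
    rw [div_le_div_iff₀ (by positivity) (by positivity)]
    nlinarith
  have hr : 1 / √(m * p 0) ≤ √(32 / (n * p 0)) := by
    refine Real.le_sqrt_of_sq_le ?_
    rw [div_pow, Real.sq_sqrt (by positivity), one_pow,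
      div_le_div_iff₀ (by positivity) (by positivity)]
    nlinarith
  have hKn : 2 ≤ 32 / (n * p 0) * ((n * p 0) * Real.exp 1) := by
    field_simp
    linarith [Real.exp_one_gt_d9]
  have hKh : 2 ≤ 32 / (n * p 0) * ((n : ℝ) / 2 * Real.exp 1) := by
    rw [show 32 / (n * p 0) * ((n : ℝ) / 2 * Real.exp 1) = 16 * Real.exp 1 / p 0 by
      field_simp; norm_num, le_div_iff₀ hq]
    linarith [Real.exp_one_gt_d9]
  have key : ∀ Y : A, ‖Y‖ ≤ 1 →
      (∀ x, x ≠ 0 → p x * ‖(T x + T (-x) - 2) * Y‖ ≤ 2 / (m * p 0)) →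
      ‖(F - 1) * Y‖ ≤ 1 / √(m * p 0) → ∀ Z : A, ‖Z‖ ≤ 1 →
      ‖Y ^ 4 * Z * (F - 1) ^ 4‖ ≤
        (32 / (n * p 0) * truncatedMass p ((n : ℝ) / 2)) ^ 2 *
        (32 / (n * p 0) * truncatedMass p (n * p 0)) * √(32 / (n * p 0)) := by
    intro Y hY h1 h2 Z hZ
    have hK : 64 / (n * p 0) / 2 ≤ 32 / (n * p 0) := le_of_eq (by ring)
    exact norm_pow_four_mul_le hZ
      (norm_sub_one_mul_le_truncatedMass hT hT0 hp hF hp0 hsymm hY (by positivity)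
        (fun x hx => (h1 x hx).trans hc) (by positivity) hK hKh)
      (norm_sub_one_mul_le_truncatedMass hT hT0 hp hF hp0 hsymm hY (by positivity)
        (fun x hx => (h1 x hx).trans hc) (by positivity) hK hKn)
      (h2.trans hr)
  rcases le_or_gt (4 * m) j with h | h
  · have e : F ^ j * E ^ (n - 2 - j) = (F ^ m) ^ 4 * (F ^ (j - 4 * m) * E ^ (n - 2 - j)) := by
      rw [← pow_mul, ← mul_assoc, ← pow_add]
      congr 2
      omega
    rw [e]
    refine key _ (hFk m) (fun x hx => ?_) ?_ _ ?_
    · refine (mul_norm_pair_mul_pow_le hT hinv hT0 hp hF hp0 hsymm hq (hneg x hx) hx m).trans ?_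
      gcongr
      linarith
    · refine (norm_sub_one_mul_pow_le_of_atom hT hT0 hp hF hp0 hq hq1 m).trans ?_
      gcongr
      linarith
    · exact (norm_mul_le _ _).trans (mul_le_one₀ (hFk _) (norm_nonneg _) (hEk _))
  · have e : F ^ j * E ^ (n - 2 - j) = (E ^ m) ^ 4 * (F ^ j * E ^ (n - 2 - j - 4 * m)) := by
      rw [← pow_mul, mul_left_comm, ← pow_add]
      congr 2
      omega
    rw [e]
    have hEm : E ^ m = NormedSpace.exp ((m : ℝ) • (F - 1)) := (exp_natCast_smul _ _).symm
    refine key _ (hEk m) (fun x hx => ?_) ?_ _ ?_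
    · rw [hEm]
      refine (mul_norm_pair_mul_exp_le hT hinv hp hF hp0 hsymm (hneg x hx) hm0).trans ?_
      rw [div_le_div_iff₀ hm0 (by positivity)]
      nlinarith
    · rw [hEm]
      refine (norm_sub_one_mul_exp_le hF1 hm0).trans ?_
      gcongr
      exact mul_le_of_le_one_right hm0.le hq1.le
    · exact (norm_mul_le _ _).trans (mul_le_one₀ (hFk _) (norm_nonneg _) (hEk _))

/-- The compound Poisson approximation bound in an arbitrary commutative Banach algebra. -/
theorem norm_pow_sub_exp_pow_le_truncatedMass (hT : ∀ x, ‖T x‖ ≤ 1)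
    (hinv : ∀ x, T x * T (-x) = 1) (hT0 : T 0 = 1) (hneg : ∀ x : G, x ≠ 0 → x ≠ -x)
    (hp : HasSum p 1) (hF : HasSum (fun x => p x • T x) F) (hp0 : ∀ x, 0 ≤ p x)
    (hsymm : ∀ x, p (-x) = p x) (hq : 0 < p 0) (hq1 : p 0 < 1) {n : ℕ} (hn : 1 ≤ n) :
    ‖F ^ n - NormedSpace.exp (F - 1) ^ n‖ / 2 ≤
      4 * truncatedMass p ((n : ℝ) / 2) ^ 2 / (Real.exp 1 ^ 2 * n) *
        (1 + 100000 * (truncatedMass p (n * p 0) + 1) / (p 0 ^ 4 * √n)) := by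
  have hn' : (1 : ℝ) ≤ n := by exact_mod_cast hn
  have hF1 : ‖F‖ ≤ 1 := norm_le_of_hasSum_smul hT hp0 hp hF
  have he : Real.exp 1 ^ 2 ≤ 8 := by nlinarith [Real.exp_one_lt_d9, Real.exp_one_gt_d9]
  have he0 := Real.exp_pos 1
  set D := truncatedMass p ((n : ℝ) / 2) with hD
  set D' := truncatedMass p (n * p 0) with hD'
  have hD0 : 0 ≤ D := truncatedMass_nonneg hp0 (by positivity)
  have hD0' : 0 ≤ D' := truncatedMass_nonneg hp0 (by positivity)
  set q := p 0
  set r := √(n : ℝ) with hr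
  have hr0 : 0 < r := Real.sqrt_pos.2 (by positivity)
  have hrn : (n : ℝ) = r ^ 2 := (Real.sq_sqrt (by positivity)).symm
  have hq4 : q ^ 4 ≤ 1 := pow_le_one₀ hq.le hq1.le
  -- For `n < 16` the crude bound is absorbed by the correction term, thanks to the `+ 1` next to
  -- `δ(nq)`.
  rcases Nat.lt_or_ge n 16 with h16 | h16
  · refine (norm_pow_sub_exp_pow_le_mul_sq hT hT0 hp hF hp0 hq1.le hn).trans ?_
    rw [← hD]
    have hn16 : (n : ℝ) ≤ 16 := by exact_mod_cast h16.le
    have hr4 : r ≤ 4 := by nlinarith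
    have h1 : (n : ℝ) * (Real.exp 1 ^ 2 * n) * (q ^ 4 * r) ≤ 400000 := by
      calc (n : ℝ) * (Real.exp 1 ^ 2 * n) * (q ^ 4 * r) ≤ 16 * (8 * 16) * (1 * 4) := by gcongr
        _ ≤ 400000 := by norm_num
    calc (n : ℝ) * D ^ 2 ≤ 4 * D ^ 2 / (Real.exp 1 ^ 2 * n) * (100000 / (q ^ 4 * r)) := by
          rw [div_mul_div_comm, le_div_iff₀ (by positivity)]
          nlinarith [mul_le_mul_of_nonneg_left h1 (sq_nonneg D)]
      _ ≤ _ := by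
          gcongr
          refine le_trans ?_ (le_add_of_nonneg_left zero_le_one)
          gcongr
          linarith
  · have h := norm_pow_sub_exp_pow_le_second_order hF1 (n := n) (by omega)
      (fun j hj => norm_mixed_pow_mul_pow_four_le hT hinv hT0 hneg hp hF hp0 hsymm hq hq1 h16 hj)
    have h2 := norm_exp_pow_mul_sq_le hT hinv hT0 hneg hp hF hp0 hsymm (n := n) (by omega)
    rw [← hD] at h h2
    rw [← hD'] at h
    have h3 : (n : ℝ) / 4 * (4 / (Real.exp 1 * n) * D) ^ 2 =
        4 * D ^ 2 / (Real.exp 1 ^ 2 * n) := by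
      field_simp
    have h4 : (n : ℝ) ^ 2 / 8 * ((32 / (n * q) * D) ^ 2 * (32 / (n * q) * D') *
        √(32 / (n * q))) ≤
        4 * D ^ 2 / (Real.exp 1 ^ 2 * n) * (100000 * (D' + 1) / (q ^ 4 * r)) := by
      have h5 : √(32 / (n * q)) ≤ 6 / (r * q) := by
        refine Real.sqrt_le_iff.2 ⟨by positivity, ?_⟩
        rw [div_pow, div_le_div_iff₀ (by positivity) (by positivity), mul_pow, ← hrn]
        have : q ^ 2 ≤ q := by nlinarith
        nlinarith [mul_le_mul_of_nonneg_left this (by positivity : (0 : ℝ) ≤ n),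
          mul_pos (show (0 : ℝ) < n by positivity) hq]
      calc (n : ℝ) ^ 2 / 8 * ((32 / (n * q) * D) ^ 2 * (32 / (n * q) * D') * √(32 / (n * q)))
          ≤ (n : ℝ) ^ 2 / 8 * ((32 / (n * q) * D) ^ 2 * (32 / (n * q) * D') *
            (6 / (r * q))) := by gcongr
        -- `49152 = 32³ * 6 / 4`; the 8 is then replaced by the smaller `e²`.
        _ = 4 * D ^ 2 / (8 * n) * (49152 * D' / (q ^ 4 * r)) := by
          field_simp
          ring
        _ ≤ _ := by
          gcongr
          · norm_num
          · linarith
    have h6 := mul_le_mul_of_nonneg_left h2 (by positivity : (0 : ℝ) ≤ n / 4)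
    rw [h3] at h6
    rw [mul_add, mul_one]
    linarith

end Law

/-! ### Signed measures on a countable group as elements of a Banach algebra. -/

section Discrete

variable {G : Type*} [MeasurableSpace G]

theorem sum_abs_singleton_le [MeasurableSingletonClass G] (M : SignedMeasure G) (s : Finset G) :
    ∑ x ∈ s, |M {x}| ≤ (M.variation Set.univ).toReal := by
  have := isFiniteMeasure_variation M
  calc ∑ x ∈ s, |M {x}| ≤ ∑ x ∈ s, M.variation.real {x} :=
        Finset.sum_le_sum fun x _ => by
          simpa using VectorMeasure.norm_measure_le_variation (μ := M) (E := {x})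
    _ = M.variation.real s := sum_measureReal_singleton s
    _ ≤ _ := measureReal_mono (Set.subset_univ _)

theorem summable_abs_singleton [MeasurableSingletonClass G] (M : SignedMeasure G) :
    Summable fun x => |M {x}| :=
  summable_of_sum_le (fun _ => abs_nonneg _) (sum_abs_singleton_le M)

theorem tsum_abs_singleton_le [MeasurableSingletonClass G] (M : SignedMeasure G) :
    ∑' x, |M {x}| ≤ (M.variation Set.univ).toReal :=
  Real.tsum_le_of_sum_le (fun _ => abs_nonneg _) (sum_abs_singleton_le M)

theorem hasSum_indicator_singleton [Countable G] [MeasurableSingletonClass G]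
    (M : SignedMeasure G) (B : Set G) :
    HasSum (fun x => B.indicator (fun x => M {x}) x) (M B) := by
  classical
  have h := M.hasSum_of_disjoint_iUnion (f := fun x : G => {x} ∩ B)
    (fun x => (Set.to_countable _).measurableSet) (fun x y hxy => by
      rw [Function.onFun, Set.disjoint_left]
      rintro z ⟨rfl, _⟩ ⟨h, _⟩
      exact hxy h)
  rw [← Set.iUnion_inter, Set.iUnion_of_singleton, Set.univ_inter] at h
  refine h.congr_fun fun x => ?_
  by_cases hx : x ∈ B <;> simp [hx]

theorem expMeasure_apply [AddCommGroup G] (M : SignedMeasure G) (B : Set G) :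
    expMeasure M B = ∑' j : ℕ, convPow M j B / (j ! : ℝ) := rfl

section Represent

variable {A : Type*} [NormedRing A] [NormedAlgebra ℝ A] {T : G → A}

/-- The element `∑ₓ M{x} T(x)` of a Banach algebra attached to a signed measure `M`. -/
noncomputable def represent (T : G → A) (M : SignedMeasure G) : A := ∑' x, M {x} • T x

variable [MeasurableSingletonClass G]

theorem summable_norm_smul (hT : ∀ x, ‖T x‖ ≤ 1) (M : SignedMeasure G) :
    Summable fun x => ‖M {x} • T x‖ := by
  refine Summable.of_nonneg_of_le (fun _ => norm_nonneg _) (fun x => ?_) (summable_abs_singleton M)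
  rw [norm_smul, Real.norm_eq_abs]
  exact mul_le_of_le_one_right (abs_nonneg _) (hT x)

theorem represent_unit [AddCommGroup G] (hT0 : T 0 = 1) : represent T (unit G) = 1 := by
  classical
  rw [represent, tsum_eq_single 0]
  · rw [unit, Measure.toSignedMeasure_apply_measurable (measurableSet_singleton 0), measureReal_def,
      Measure.dirac_apply' _ (measurableSet_singleton 0)]
    simp [hT0]
  · intro x hx
    rw [unit, Measure.toSignedMeasure_apply_measurable (measurableSet_singleton x), measureReal_def,
      Measure.dirac_apply' _ (measurableSet_singleton x)]
    simp [hx.symm]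

variable [CompleteSpace A]

theorem hasSum_represent (hT : ∀ x, ‖T x‖ ≤ 1) (M : SignedMeasure G) :
    HasSum (fun x => M {x} • T x) (represent T M) :=
  (summable_norm_smul hT M).of_norm.hasSum

theorem represent_smul_sub (hT : ∀ x, ‖T x‖ ≤ 1) (c : ℝ) (M V : SignedMeasure G) :
    represent T (c • (M - V)) = c • (represent T M - represent T V) := by
  refine HasSum.tsum_eq ?_
  refine (((hasSum_represent hT M).sub (hasSum_represent hT V)).const_smul c).congr_fun fun x => ?_
  simp [mul_smul, sub_smul]

end Represent

theorem toSignedMeasure_singleton [MeasurableSingletonClass G] (F : Measure G) [IsFiniteMeasure F]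
    (x : G) : F.toSignedMeasure {x} = F.real {x} :=
  Measure.toSignedMeasure_apply_measurable (measurableSet_singleton x)

theorem hasSum_measureReal_singleton [Countable G] [MeasurableSingletonClass G] (F : Measure G)
    [IsProbabilityMeasure F] : HasSum (fun x => F.real {x}) 1 := by
  have h := hasSum_indicator_singleton F.toSignedMeasure Set.univ
  simpa [toSignedMeasure_singleton, Measure.toSignedMeasure_apply_measurable MeasurableSet.univ]
    using h

variable [AddCommGroup G] [Countable G] [MeasurableSingletonClass G]

theorem hasSum_conv_singleton (M V : SignedMeasure G) (z : G) :
    HasSum (fun x => M {x} * V {z - x}) (conv M V {z}) := by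
  have := isFiniteMeasure_variation M
  have hm : Measurable (fun p : G × G => p.1 + p.2) := measurable_of_countable _
  rw [conv, VectorMeasure.map_apply _ hm (measurableSet_singleton z)]
  have h := (VectorMeasure.prod M V (ContinuousLinearMap.mul ℝ ℝ)).hasSum_of_disjoint_iUnion
    (f := fun x : G => ({x} ×ˢ {z - x} : Set (G × G)))
    (fun x => (Set.to_countable _).measurableSet) (fun x y hxy => by
      rw [Function.onFun, Set.disjoint_left]
      rintro ⟨a, b⟩ ⟨rfl, _⟩ ⟨h, _⟩
      exact hxy h)
  have e : (⋃ x : G, ({x} ×ˢ {z - x} : Set (G × G))) = (fun p : G × G => p.1 + p.2) ⁻¹' {z} := by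
    ext ⟨a, b⟩
    simp only [Set.mem_iUnion, Set.mem_prod, Set.mem_singleton_iff, exists_eq_left',
      Set.mem_preimage, eq_sub_iff_add_eq, add_comm b a]
  rw [e] at h
  simpa only [VectorMeasure.prod_apply, ContinuousLinearMap.mul_apply'] using h

variable {A : Type*} [NormedRing A] [NormedAlgebra ℝ A] [CompleteSpace A] {T : G → A}

theorem represent_conv (hT : ∀ x, ‖T x‖ ≤ 1) (hadd : ∀ x y, T (x + y) = T x * T y)
    (M V : SignedMeasure G) : represent T (conv M V) = represent T M * represent T V := by
  have h := (summable_mul_of_summable_norm (summable_norm_smul hT M)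
    (summable_norm_smul hT V)).hasSum
  rw [← tsum_mul_tsum_of_summable_norm (summable_norm_smul hT M) (summable_norm_smul hT V)] at h
  let e : G × G ≃ G × G :=
    { toFun := fun p => (p.2, p.1 - p.2)
      invFun := fun p => (p.1 + p.2, p.1)
      left_inv := fun p => by simp
      right_inv := fun p => by simp }
  have h2 := (e.hasSum_iff.2 h).prod_fiberwise (g := fun z => conv M V {z} • T z) fun z => by
    refine ((hasSum_conv_singleton M V z).smul_const (T z)).congr_fun fun x => ?_
    simp only [Function.comp_apply, e, Equiv.coe_fn_mk, smul_mul_smul_comm, ← hadd,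
      add_sub_cancel]
  exact h2.tsum_eq

theorem represent_convPow (hT : ∀ x, ‖T x‖ ≤ 1) (hadd : ∀ x y, T (x + y) = T x * T y)
    (hT0 : T 0 = 1) (M : SignedMeasure G) (j : ℕ) :
    represent T (convPow M j) = represent T M ^ j := by
  induction j with
  | zero => rw [convPow, represent_unit hT0, pow_zero]
  | succ j ih => rw [convPow, represent_conv hT hadd, ih, pow_succ]

/-- The double series over `j` and `x` converges absolutely, being dominated by the exponential
series of the total variation of `M`, so the two orders of summation agree. -/
theorem represent_expMeasure (hT : ∀ x, ‖T x‖ ≤ 1) (hadd : ∀ x y, T (x + y) = T x * T y)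
    (hT0 : T 0 = 1) (M : SignedMeasure G) :
    represent T (expMeasure M) = NormedSpace.exp (represent T M) := by
  have := isFiniteMeasure_variation M
  set a : ℝ := (M.variation Set.univ).toReal with ha
  have hbound : ∀ j, ((convPow M j).variation Set.univ).toReal ≤ a ^ j := by
    intro j
    rw [ha, ← ENNReal.toReal_pow]
    exact ENNReal.toReal_mono (by finiteness) (variation_convPow_le M j)
  have hs : Summable fun p : ℕ × G => |convPow M p.1 {p.2} / (p.1 ! : ℝ)| := by
    refine (summable_prod_of_nonneg (fun _ => abs_nonneg _)).2 ⟨fun j => ?_, ?_⟩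
    · simpa [abs_div] using (summable_abs_singleton (convPow M j)).div_const _
    · refine Summable.of_nonneg_of_le (fun j => tsum_nonneg fun _ => abs_nonneg _) (fun j => ?_)
        (Real.summable_pow_div_factorial a)
      simp only [abs_div, Nat.abs_cast]
      rw [tsum_div_const]
      gcongr
      exact (tsum_abs_singleton_le (convPow M j)).trans (hbound j)
  have hsT : Summable fun p : ℕ × G => (convPow M p.1 {p.2} / (p.1 ! : ℝ)) • T p.2 := by
    refine Summable.of_norm_bounded hs fun p => ?_
    rw [norm_smul, Real.norm_eq_abs]
    exact mul_le_of_le_one_right (abs_nonneg _) (hT _)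
  have h1 := hsT.hasSum.prod_fiberwise
    (g := fun j => ((j ! : ℝ)⁻¹) • represent T M ^ j) fun j => by
      rw [← represent_convPow hT hadd hT0]
      refine ((hasSum_represent hT (convPow M j)).const_smul _).congr_fun fun x => ?_
      rw [smul_smul, div_eq_inv_mul]
  have h2 := hsT.prod_symm.hasSum.prod_fiberwise (g := fun x => expMeasure M {x} • T x) fun x => by
      have h3 : Summable fun p : ℕ × G => convPow M p.1 {p.2} / (p.1 ! : ℝ) := hs.of_abs
      rw [expMeasure_apply]
      exact (h3.prod_symm.prod_factor x).hasSum.smul_const (T x)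
  rw [represent, h2.tsum_eq, (NormedSpace.exp_series_hasSum_exp' (𝕂 := ℝ) _).unique h1]
  exact (Equiv.prodComm G ℕ).tsum_eq
    fun p : ℕ × G => (convPow M p.1 {p.2} / (p.1 ! : ℝ)) • T p.2

end Discrete

/-! ### Reduction from a general Banach algebra to a commutative one. -/

section Noncommutative

/-- The approximation bound for commuting elements of an arbitrary Banach algebra. -/
theorem norm_pow_sub_exp_pow_le_of_commute {A G : Type*} [NormedRing A] [NormedAlgebra ℝ A]
    [NormOneClass A] [CompleteSpace A] [AddCommGroup G] {T : G → A} {p : G → ℝ} {F : A}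
    (hT : ∀ x, ‖T x‖ ≤ 1)
    (hadd : ∀ x y, T (x + y) = T x * T y) (hT0 : T 0 = 1) (hneg : ∀ x : G, x ≠ 0 → x ≠ -x)
    (hp : HasSum p 1) (hF : HasSum (fun x => p x • T x) F) (hp0 : ∀ x, 0 ≤ p x)
    (hsymm : ∀ x, p (-x) = p x) (hq : 0 < p 0) (hq1 : p 0 < 1) {n : ℕ} (hn : 1 ≤ n) :
    ‖F ^ n - NormedSpace.exp ((n : ℝ) • (F - 1))‖ / 2 ≤
      4 * truncatedMass p ((n : ℝ) / 2) ^ 2 / (Real.exp 1 ^ 2 * n) *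
        (1 + 100000 * (truncatedMass p (n * p 0) + 1) / (p 0 ^ 4 * √n)) := by
  -- The `T x` commute, so their closed span algebra is a commutative Banach algebra; it contains
  -- `F` and its exponentials, with the same norms.
  let S : Subalgebra ℝ A := (Algebra.adjoin ℝ (Set.range T)).topologicalClosure
  have hcomm : ∀ x y : S, x * y = y * x := by
    have h1 : IsMulCommutative (Algebra.adjoin ℝ (Set.range T)) :=
      Algebra.isMulCommutative_adjoin ℝ (by
        rintro _ ⟨x, rfl⟩ _ ⟨y, rfl⟩
        rw [← hadd, ← hadd, add_comm])
    exact (Subalgebra.commRingTopologicalClosure _ h1.is_comm.comm).mul_comm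
  let : NormedCommRing S := { (inferInstance : NormedRing S) with mul_comm := hcomm }
  have : CompleteSpace S :=
    (Subalgebra.isClosed_topologicalClosure (Algebra.adjoin ℝ (Set.range T))).completeSpace_coe
  have : NormOneClass S := ⟨norm_one (α := A)⟩
  let T' : G → S := fun x =>
    ⟨T x, Subalgebra.le_topologicalClosure _ (Algebra.subset_adjoin ⟨x, rfl⟩)⟩
  have hT' : ∀ x, ‖T' x‖ ≤ 1 := hT
  have hT0' : T' 0 = 1 := Subtype.ext hT0
  have hinv' : ∀ x, T' x * T' (-x) = 1 := fun x => Subtype.ext <| by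
    change T x * T (-x) = 1
    rw [← hadd, add_neg_cancel, hT0]
  have hF' : HasSum (fun x => p x • T' x) (∑' x, p x • T' x) := by
    refine (Summable.of_norm_bounded hp.summable fun x => ?_).hasSum
    rw [norm_smul, Real.norm_of_nonneg (hp0 x)]
    exact mul_le_of_le_one_right (hp0 x) (hT' x)
  set F' : S := ∑' x, p x • T' x
  have hcont : Continuous S.val := continuous_subtype_val
  have hFF : S.val F' = F := (hF'.map S.val hcont).unique hF
  have h := norm_pow_sub_exp_pow_le_truncatedMass hT' hinv' hT0' hneg hp hF' hp0 hsymm hq hq1 hn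
  have hexp : S.val (NormedSpace.exp ((n : ℝ) • (F' - 1))) =
      NormedSpace.exp ((n : ℝ) • (F - 1)) := by
    let : NormedAlgebra ℚ S := NormedAlgebra.restrictScalars ℚ ℝ S
    let : NormedAlgebra ℚ A := NormedAlgebra.restrictScalars ℚ ℝ A
    rw [NormedSpace.map_exp S.val hcont, map_smul, map_sub, map_one, hFF]
  rw [← exp_natCast_smul] at h
  have e : ‖F ^ n - NormedSpace.exp ((n : ℝ) • (F - 1))‖ =
      ‖F' ^ n - NormedSpace.exp ((n : ℝ) • (F' - 1))‖ := by
    rw [← hexp, ← hFF, ← map_pow, ← map_sub]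
    rfl
  rw [e]
  exact h

/-- The compound Poisson approximation bound for the elements of a Banach algebra attached to
`F ^ n` and `exp {n (F - I)}`. -/
theorem norm_represent_convPow_sub_expMeasure_le {A G : Type*} [NormedRing A] [NormedAlgebra ℝ A]
    [NormOneClass A] [CompleteSpace A] [AddCommGroup G] [MeasurableSpace G] [Countable G]
    [MeasurableSingletonClass G] {T : G → A} (hT : ∀ x, ‖T x‖ ≤ 1)
    (hadd : ∀ x y, T (x + y) = T x * T y) (hT0 : T 0 = 1)
    (F : Measure G) [IsProbabilityMeasure F]
    (hneg : ∀ x : G, x ≠ 0 → x ≠ -x) (hsymm : ∀ x, F.real {-x} = F.real {x})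
    (hq : 0 < F.real {0}) (hq1 : F.real {0} < 1) {n : ℕ} (hn : 1 ≤ n) :
    ‖represent T (convPow F.toSignedMeasure n) -
        represent T (expMeasure ((n : ℝ) • (F.toSignedMeasure - unit G)))‖ / 2 ≤
      4 * truncatedMass (fun x => F.real {x}) ((n : ℝ) / 2) ^ 2 / (Real.exp 1 ^ 2 * n) *
        (1 + 100000 * (truncatedMass (fun x => F.real {x}) (n * F.real {0}) + 1) /
          (F.real {0} ^ 4 * √n)) := by
  have hF : HasSum (fun x => F.real {x} • T x) (represent T F.toSignedMeasure) := by
    simpa only [toSignedMeasure_singleton] using hasSum_represent hT F.toSignedMeasure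
  rw [represent_convPow hT hadd hT0, represent_expMeasure hT hadd hT0, represent_smul_sub hT,
    represent_unit hT0]
  exact norm_pow_sub_exp_pow_le_of_commute hT hadd hT0 hneg (hasSum_measureReal_singleton F) hF
    (fun _ => measureReal_nonneg) hsymm hq hq1 hn

theorem exp_apply_of_apply_eq_zero {E : Type*} [NormedAddCommGroup E] [NormedSpace ℝ E]
    [CompleteSpace E] {X : E →L[ℝ] E} {v : E} (h : X v = 0) : NormedSpace.exp X v = v := by
  have h1 := (ContinuousLinearMap.apply ℝ E v).hasSum
    (NormedSpace.exp_series_hasSum_exp' (𝕂 := ℝ) X)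
  have h2 := hasSum_single (L := .unconditional ℕ)
    (f := fun k : ℕ => ContinuousLinearMap.apply ℝ E v ((k ! : ℝ)⁻¹ • X ^ k)) 0 (fun k hk => by
      obtain ⟨j, rfl⟩ := Nat.exists_eq_succ_of_ne_zero hk
      simp [pow_succ, h])
  simpa using h1.unique h2

/-- Applied to the constant function 1, this says that the two measures have equal total mass: a
vector fixed by the operator of `M` is fixed by both operators. -/
theorem represent_convPow_apply_eq_represent_expMeasure_apply {E G : Type*} [NormedAddCommGroup E]
    [NormedSpace ℝ E] [CompleteSpace E] [AddCommGroup G] [MeasurableSpace G] [Countable G]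
    [MeasurableSingletonClass G] {T : G → E →L[ℝ] E} (hT : ∀ x, ‖T x‖ ≤ 1)
    (hadd : ∀ x y, T (x + y) = T x * T y) (hT0 : T 0 = 1) {M : SignedMeasure G} {v : E}
    (hv : represent T M v = v) (n : ℕ) :
    represent T (convPow M n) v = represent T (expMeasure ((n : ℝ) • (M - unit G))) v := by
  rw [represent_convPow hT hadd hT0, represent_expMeasure hT hadd hT0, represent_smul_sub hT,
    represent_unit hT0, exp_apply_of_apply_eq_zero (by simp [hv])]
  induction n with
  | zero => simp
  | succ k ih => rw [pow_succ, mul_apply_eq_comp, hv, ih]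

end Noncommutative

/-! ### Total variation through translation operators. -/

section Translation

open BoundedContinuousFunction

variable {G : Type*} [AddCommGroup G] [TopologicalSpace G] [DiscreteTopology G]

/-- Translation by `x`, as an operator on the bounded functions. -/
noncomputable def translation (x : G) : (G →ᵇ ℝ) →L[ℝ] (G →ᵇ ℝ) :=
  LinearMap.mkContinuous
    { toFun := fun f => f.compContinuous ⟨fun y => y + x, continuous_of_discreteTopology⟩
      map_add' := fun _ _ => rfl
      map_smul' := fun _ _ => rfl } 1 fun f => by
    rw [one_mul]
    exact (BoundedContinuousFunction.norm_le (norm_nonneg f)).2 fun y => f.norm_coe_le_norm _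

@[simp]
theorem translation_apply (x y : G) (f : G →ᵇ ℝ) : translation x f y = f (y + x) := rfl

theorem norm_translation_le (x : G) : ‖translation x‖ ≤ 1 :=
  LinearMap.mkContinuous_norm_le _ zero_le_one _

theorem translation_zero : translation (0 : G) = 1 := by
  ext f y; simp

theorem translation_add (x y : G) : translation (x + y) = translation x * translation y := by
  ext f z; simp [add_assoc]

variable [MeasurableSpace G] [MeasurableSingletonClass G]

theorem hasSum_represent_translation_apply (M : SignedMeasure G) (f : G →ᵇ ℝ) (y : G) :
    HasSum (fun x => M {x} * f (y + x)) (represent translation M f y) := by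
  have h := (BoundedContinuousFunction.evalCLM ℝ y ∘L
    ContinuousLinearMap.apply ℝ (G →ᵇ ℝ) f).hasSum
    (hasSum_represent (T := translation) norm_translation_le M)
  simpa using h

variable [Countable G]

/-- The total variation distance of two signed measures of equal mass is at most half the
distance of the convolution operators. -/
theorem tvDist_le_norm_represent_sub (M V : SignedMeasure G)
    (h : represent translation M (BoundedContinuousFunction.const G 1) =
      represent translation V (BoundedContinuousFunction.const G 1)) :
    tvDist M V ≤ ‖represent (translation (G := G)) M - represent translation V‖ / 2 := by
  classical
  have : Nonempty {B : Set G // MeasurableSet B} := ⟨⟨∅, MeasurableSet.empty⟩⟩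
  refine ciSup_le fun B => ?_
  set B : Set G := B.1
  -- Centring the indicator at `1/2` halves its norm, which gives the factor `1/2`; equality of
  -- masses cancels the constant added back in `g`.
  let f : G →ᵇ ℝ := BoundedContinuousFunction.ofNormedAddCommGroupDiscrete
    (fun x => B.indicator 1 x - 1 / 2) (1 / 2) fun x => by
      by_cases hx : x ∈ B <;> norm_num [hx, abs_of_pos]
  have hf : ‖f‖ ≤ 1 / 2 :=
    BoundedContinuousFunction.norm_ofNormedAddCommGroup_le _ (by norm_num) _
  let g : G →ᵇ ℝ := f + (1 / 2 : ℝ) • BoundedContinuousFunction.const G 1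
  have hg : ∀ W : SignedMeasure G, represent translation W g 0 = W B := fun W => by
    refine (hasSum_represent_translation_apply W g 0).unique ?_
    refine (hasSum_indicator_singleton W B).congr_fun fun x => ?_
    by_cases hx : x ∈ B <;> simp [g, f, hx]
  rw [← hg M, ← hg V]
  have e : represent translation M g 0 - represent translation V g 0 =
      (represent translation M - represent translation V) f 0 := by
    simp [g, h]
  rw [e, ← Real.norm_eq_abs]
  calc _ ≤ ‖(represent translation M - represent translation V) f‖ :=
        BoundedContinuousFunction.norm_coe_le_norm _ _
    _ ≤ ‖represent (translation (G := G)) M - represent translation V‖ * ‖f‖ :=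
        ContinuousLinearMap.le_opNorm _ _
    _ ≤ ‖represent (translation (G := G)) M - represent translation V‖ * (1 / 2) := by gcongr
    _ = _ := by ring

theorem tvDist_convPow_expMeasure_le (F : Measure G) [IsProbabilityMeasure F]
    (hneg : ∀ x : G, x ≠ 0 → x ≠ -x) (hsymm : ∀ x, F.real {-x} = F.real {x})
    (hq : 0 < F.real {0}) (hq1 : F.real {0} < 1) {n : ℕ} (hn : 1 ≤ n) :
    tvDist (convPow F.toSignedMeasure n)
        (expMeasure ((n : ℝ) • (F.toSignedMeasure - unit G))) ≤
      4 * truncatedMass (fun x => F.real {x}) ((n : ℝ) / 2) ^ 2 / (Real.exp 1 ^ 2 * n) *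
        (1 + 100000 * (truncatedMass (fun x => F.real {x}) (n * F.real {0}) + 1) /
          (F.real {0} ^ 4 * √n)) := by
  have hT := norm_translation_le (G := G)
  have : Nontrivial (G →ᵇ ℝ) := ⟨0, BoundedContinuousFunction.const G 1, fun h => by
    simpa using DFunLike.congr_fun h 0⟩
  have h1 : represent translation F.toSignedMeasure (BoundedContinuousFunction.const G 1) =
      BoundedContinuousFunction.const G 1 := by
    ext y
    refine (hasSum_represent_translation_apply _ _ y).unique ?_
    simpa [toSignedMeasure_singleton] using hasSum_measureReal_singleton F
  refine (tvDist_le_norm_represent_sub _ _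
    (represent_convPow_apply_eq_represent_expMeasure_apply hT translation_add translation_zero
      h1 n)).trans ?_
  exact norm_represent_convPow_sub_expMeasure_le hT translation_add translation_zero F hneg hsymm
    hq hq1 hn

end Translation

end CompoundPoisson

/-! ### The theorem on `ℤ^d`. -/

theorem theorem1 :
    ∃ C : ℝ, 0 < C ∧
      ∀ (d : ℕ) (F : Measure (Fin d → ℤ)) [IsProbabilityMeasure F] (q : ℝ),
        F.map (fun x => -x) = F → q = F.real {0} → 0 < q → q < 1 →
        ∀ n : ℕ, 1 ≤ n →
          CompoundPoisson.tvDist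
              (CompoundPoisson.convPow F.toSignedMeasure n)
              (CompoundPoisson.expMeasure
                ((n : ℝ) • (F.toSignedMeasure - CompoundPoisson.unit (Fin d → ℤ))))
            ≤ 4 * CompoundPoisson.delta F ((n : ℝ) / 2) ^ 2 / (Real.exp 1 ^ 2 * (n : ℝ))
                * (1 + C * (CompoundPoisson.delta F ((n : ℝ) * q) + 1)
                    / (q ^ 4 * Real.sqrt (n : ℝ)))
              + C * (1 - q) ^ (9 / 2 : ℝ) / (q ^ 5 * ((n : ℝ) * Real.sqrt (n : ℝ))) := by
  refine ⟨100000, by norm_num, ?_⟩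
  intro d F _ q hF hq hq0 hq1 n hn
  have hsymm : ∀ x : Fin d → ℤ, F.real {-x} = F.real {x} := fun x => by
    conv_rhs => rw [← hF]
    rw [map_measureReal_apply (measurable_of_countable _) (measurableSet_singleton x)]
    congr 1
    ext y
    simp
  -- `ℤ^d` has no 2-torsion.
  have hneg : ∀ x : Fin d → ℤ, x ≠ 0 → x ≠ -x := fun x hx h => hx <| by
    ext i
    have := congrFun h i
    simp only [Pi.neg_apply] at this
    simp only [Pi.zero_apply]
    omega
  subst hq
  refine (CompoundPoisson.tvDist_convPow_expMeasure_le F hneg hsymm hq0 hq1 hn).trans ?_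
  -- The first term already suffices; the second is only needed to be nonnegative.
  refine le_add_of_nonneg_right ?_
  have : 0 ≤ 1 - F.real {0} := by linarith
  positivity
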